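/- Let $L\in\mathbb{N}$ and let $V:\mathbb{Z}\to\mathbb{C}^{L\times L}$ satisfy $V(n)=V(n)^*$ for all $n$ and $\sum_{n\in\mathbb{Z}}\|nV(n)\|<\infty$. For matrix-valued sequences put $(Hu)(n)=u(n+1)+u(n-1)+V(n)u(n)$, and let $\overline{\mathbb{D}}$ and $\mathbb{S}^1$ be the closed unit disk and the unit circle in $\mathbb{C}$. **Notation.** For every $z\in\overline{\mathbb{D}}\setminus\{0\}$ there are unique solutions $u_+^z$ and $u_-^{1/z}$ (the Jost solutions) of $Hu=(z+1/z)u$ with $u_+^z(n)=z^n(\mathbf 1+o(1))$ as $n\to+\infty$ and $u_-^{1/z}(n)=z^{-n}(\mathbf 1+o(1))$ as $n\to-\infty$. For $z\in\mathbb{S}^1\setminus\{\pm1\}$ there are unique matrices $M^z_\pm,N^z_\pm$ with $$u_+^z=u_-^zM_+^z+u_-^{1/z}N_+^z,\qquad u_-^{1/z}=u_+^zN_-^z+u_+^{1/z}M_-^z .$$ With $W(u,v)=i\,(u(n+1)^*v(n)-u(n)^*v(n+1))$ (independent of $n$ for the solutions used here) and $\nu^z=i/(z-z^{-1})$, one has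 $M_+^z=\nu^zW(u_-^{1/\bar z},u_+^z)$, $M_-^z=-\nu^zW(u_+^{\bar z},u_-^{1/z})$, $N_+^z=-\nu^zW(u_-^{1/z},u_+^z)$, $N_-^z=\nu^zW(u_+^z,u_-^{1/z})$ there, and the first two formulas define $M^z_\pm$ for all $z\in\overline{\mathbb{D}}\setminus\{-1,0,1\}$. Put $T_\pm^z=(M_\pm^z)^{-1}$ and, on the circle, $R_\pm^z=-N_\pm^z(M_\pm^z)^{-1}$. Let $\mathcal N=\operatorname{Ker}W(u_-^1,u_+^1)$ and $\mathcal L=\operatorname{Ker}W(u_+^1,u_-^1)$; these are the sets of $\xi$ (respectively $\chi$) in $\mathbb{C}^L$ for which $u_+^1\xi$ (respectively $u_-^1\chi$) is bounded on $\mathbb{Z}$. For $\xi\in\mathcal N$ the series in $\Gamma\xi=\xi-\sum_{j\in\mathbb{Z}}jV(j)u_+^1(j)\xi$ converges, and $\Gamma$ is a linear isomorphism $\mathcal N\to\mathcal L$. The matrix $u_+^1(m)$ is invertible for all large $m$; for a site $m$ where it is, put $\Omega=u_+^1(m)^{-1}u_-^1(m)$. Let $v_1,\dots,v_L$ and $e_1,\dots,e_L$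 be orthonormal bases of $\mathbb{C}^L$ whose first $d$ vectors lie in $\mathcal N$ (respectively $\mathcal L$) and whose remaining vectors lie in $\mathcal N^\perp$ (respectively $\mathcal L^\perp$). Let $Q$ be the matrix with columns $v_k$, let $P$ be the adjoint of the matrix with columns $e_i$, and let $A$ be the $d\times d$ matrix of $P_{\mathcal L}(\Omega^*+\Gamma)P_{\mathcal N}:\mathcal N\to\mathcal L$ in the bases $(v_k)_{k\le d}$, $(e_i)_{i\le d}$, where $P_{\mathcal L},P_{\mathcal N}$ are the orthogonal projections. **Theorem.** All the assertions made above hold. Moreover: 1. There is a neighborhood of $1$ such that $M_+^z$ and $M_-^z$ are invertible for all $z\neq1$ in this neighborhood with $z\in\overline{\mathbb{D}}$. 2. The limits $T_\pm^1=\lim_{z\to1}T_\pm^z$ exist, taken in $\overline{\mathbb{D}}\setminus\{1\}$. For every site $m$ and every pair of bases as above, $A$ is invertible and $$T_+^1=Q\begin{pmatrix}2A^{-1}&0\\0&0\end{pmatrix}P,\qquad T_-^1=(T_+^1)^* .$$ 3. $T_+^1\mathbb{C}^L=\mathcal N$, $\operatorname{Ker}T_+^1=W(u_-^1,u_+^1)\mathbb{C}^L$,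 $T_-^1\mathbb{C}^L=\mathcal L$ and $\operatorname{Ker}T_-^1=W(u_+^1,u_-^1)\mathbb{C}^L$. 4. The limits $R_\pm^1=\lim_{z\to1}R_\pm^z$ exist, taken in $\mathbb{S}^1\setminus\{1\}$, and $R_+^1=\mathbf 1-\Gamma T_+^1$, $R_-^1=\mathbf 1-\Gamma^{-1}T_-^1$. 5. $(\mathbf 1-R_+^1)\mathbb{C}^L=\mathcal L$, $\operatorname{Ker}(\mathbf 1-R_+^1)=\operatorname{Ker}T_+^1$, $(\mathbf 1-R_-^1)\mathbb{C}^L=\mathcal N$ and $\operatorname{Ker}(\mathbf 1-R_-^1)=\operatorname{Ker}T_-^1$. -/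

import Mathlib

open Filter Topology
open scoped Matrix

noncomputable section

namespace MatrixSchrodinger

/-- The space `ℂ^L` with its Euclidean inner product. -/
abbrev Vec (L : ℕ) : Type := EuclideanSpace ℂ (Fin L)

/-- The `L × L` complex matrices. -/
abbrev Mat (L : ℕ) : Type := Matrix (Fin L) (Fin L) ℂ

/-- A matrix regarded as a linear operator on the Euclidean space `ℂ^L`. -/
abbrev lin {L : ℕ} (M : Mat L) : Vec L →ₗ[ℂ] Vec L := Matrix.toEuclideanLin M

/-- `∑_n ‖n V(n)‖ < ∞`, with the operator norm on matrices. -/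
def FiniteFirstMoment {L : ℕ} (V : ℤ → Mat L) : Prop :=
  Summable fun n : ℤ => ‖Matrix.toEuclideanCLM (𝕜 := ℂ) ((n : ℂ) • V n)‖

/-- The Schrödinger operator `H = H₀ + V` acting on matrix-valued sequences. -/
def hamiltonian {L : ℕ} (V u : ℤ → Mat L) : ℤ → Mat L :=
  fun n => u (n + 1) + u (n - 1) + V n * u n

/-- `H u = E u` with `E = z + 1/z`. -/
def IsSolution {L : ℕ} (V : ℤ → Mat L) (z : ℂ) (u : ℤ → Mat L) : Prop :=
  ∀ n, hamiltonian V u n = (z + z⁻¹) • u n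

/-- `u = u_+^z`: a solution with `u(n) = z^n (1 + o(1))` as `n → +∞`. -/
def IsJostPlus {L : ℕ} (V : ℤ → Mat L) (z : ℂ) (u : ℤ → Mat L) : Prop :=
  IsSolution V z u ∧ Tendsto (fun n : ℤ => (z ^ n)⁻¹ • u n) atTop (𝓝 1)

/-- `u = u_-^w`: a solution with `u(n) = w^n (1 + o(1))` as `n → -∞`. -/
def IsJostMinus {L : ℕ} (V : ℤ → Mat L) (w : ℂ) (u : ℤ → Mat L) : Prop :=
  IsSolution V w u ∧ Tendsto (fun n : ℤ => (w ^ n)⁻¹ • u n) atBot (𝓝 1)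

/-- The Jost solution `u_+^z`, for `0 < |z| ≤ 1`. -/
def jostPlus {L : ℕ} (V : ℤ → Mat L) (z : ℂ) : ℤ → Mat L :=
  Classical.epsilon (IsJostPlus V z)

/-- The Jost solution `u_-^w`, for `1 ≤ |w|`. -/
def jostMinus {L : ℕ} (V : ℤ → Mat L) (w : ℂ) : ℤ → Mat L :=
  Classical.epsilon (IsJostMinus V w)

/-- `W(u,v)(n) = i (u(n+1)^* v(n) - u(n)^* v(n+1))`. -/
def wronskianAt {L : ℕ} (u v : ℤ → Mat L) (n : ℤ) : Mat L :=
  Complex.I • ((u (n + 1))ᴴ * v n - (u n)ᴴ * v (n + 1))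

/-- The Wronskian of solutions `H u = Ē u`, `H v = E v` does not depend on the site. -/
theorem wronskianAt_eq {L : ℕ} {V : ℤ → Mat L} (hV : ∀ n, (V n).IsHermitian) {z : ℂ}
    {u v : ℤ → Mat L} (hu : IsSolution V (star z) u) (hv : IsSolution V z v) (n : ℤ) :
    wronskianAt u v n = wronskianAt u v 0 := by
  have step : ∀ k : ℤ, wronskianAt u v k = wronskianAt u v (k - 1) := by
    intro k
    have h1 := congrArg Matrix.conjTranspose (hu k)
    have h2 := hv k
    simp only [hamiltonian, Matrix.conjTranspose_add, Matrix.conjTranspose_mul,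
      Matrix.conjTranspose_smul, (hV k).eq, star_add, star_inv₀, star_star] at h1 h2
    have e1 : (u (k + 1))ᴴ = (z + z⁻¹) • (u k)ᴴ - (u (k - 1))ᴴ - (u k)ᴴ * V k := by
      rw [← h1]; abel
    have e2 : v (k + 1) = (z + z⁻¹) • v k - v (k - 1) - V k * v k := by
      rw [← h2]; abel
    simp only [wronskianAt, sub_add_cancel, e1, e2, sub_mul, mul_sub, Matrix.smul_mul,
      Matrix.mul_smul, Matrix.mul_assoc]
    congr 1
    abel
  induction n using Int.induction_on with
  | zero => rfl
  | succ i ih => rw [step, add_sub_cancel_right, ih]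
  | pred i ih => rw [← step, ih]

/-- The Wronskian of two solutions at conjugate energies (evaluated at the site `0`). -/
def wronskian {L : ℕ} (u v : ℤ → Mat L) : Mat L := wronskianAt u v 0

/-- `ν^z = i / (z - 1/z)`. -/
def nu (z : ℂ) : ℂ := Complex.I / (z - z⁻¹)

/-- `M_+^z = ν^z W(u_-^{1/z̄}, u_+^z)`. -/
def MPlus {L : ℕ} (V : ℤ → Mat L) (z : ℂ) : Mat L :=
  nu z • wronskian (jostMinus V (star z)⁻¹) (jostPlus V z)

/-- `M_-^z = -ν^z W(u_+^{z̄}, u_-^{1/z})`. -/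
def MMinus {L : ℕ} (V : ℤ → Mat L) (z : ℂ) : Mat L :=
  -nu z • wronskian (jostPlus V (star z)) (jostMinus V z⁻¹)

/-- `N_+^z = -ν^z W(u_-^{1/z}, u_+^z)`, for `|z| = 1`. -/
def NPlus {L : ℕ} (V : ℤ → Mat L) (z : ℂ) : Mat L :=
  -nu z • wronskian (jostMinus V z⁻¹) (jostPlus V z)

/-- `N_-^z = ν^z W(u_+^z, u_-^{1/z})`, for `|z| = 1`. -/
def NMinus {L : ℕ} (V : ℤ → Mat L) (z : ℂ) : Mat L :=
  nu z • wronskian (jostPlus V z) (jostMinus V z⁻¹)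

/-- The transmission coefficient `T_+^z = (M_+^z)⁻¹`. -/
def TPlus {L : ℕ} (V : ℤ → Mat L) (z : ℂ) : Mat L := (MPlus V z)⁻¹

/-- The transmission coefficient `T_-^z = (M_-^z)⁻¹`. -/
def TMinus {L : ℕ} (V : ℤ → Mat L) (z : ℂ) : Mat L := (MMinus V z)⁻¹

/-- The reflection coefficient `R_+^z = -N_+^z (M_+^z)⁻¹`. -/
def RPlus {L : ℕ} (V : ℤ → Mat L) (z : ℂ) : Mat L := -NPlus V z * (MPlus V z)⁻¹

/-- The reflection coefficient `R_-^z = -N_-^z (M_-^z)⁻¹`. -/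
def RMinus {L : ℕ} (V : ℤ → Mat L) (z : ℂ) : Mat L := -NMinus V z * (MMinus V z)⁻¹

/-- `W(u_-^1, u_+^1)`. -/
def wMinusPlus {L : ℕ} (V : ℤ → Mat L) : Mat L := wronskian (jostMinus V 1) (jostPlus V 1)

/-- `W(u_+^1, u_-^1)`. -/
def wPlusMinus {L : ℕ} (V : ℤ → Mat L) : Mat L := wronskian (jostPlus V 1) (jostMinus V 1)

/-- `𝒩 = Ker W(u_-^1, u_+^1)`. -/
def spaceN {L : ℕ} (V : ℤ → Mat L) : Submodule ℂ (Vec L) := LinearMap.ker (lin (wMinusPlus V))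

/-- `ℒ = Ker W(u_+^1, u_-^1)`. -/
def spaceL {L : ℕ} (V : ℤ → Mat L) : Submodule ℂ (Vec L) := LinearMap.ker (lin (wPlusMinus V))

/-- The matrix of a linear map `G : K → K'` between subspaces of `ℂ^L`, extended by `0` on the
orthogonal complement of `K`. -/
def extendMat {L : ℕ} {K K' : Submodule ℂ (Vec L)} (G : K →ₗ[ℂ] K') : Mat L :=
  Matrix.toEuclideanLin.symm
    (K'.subtype ∘ₗ G ∘ₗ (K.orthogonalProjectionOnto : Vec L →ₗ[ℂ] K))

/-- `Ω = u_+^1(m)⁻¹ u_-^1(m)`, formed at a site `m` where `u_+^1(m)` is invertible. -/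
def Omega {L : ℕ} (V : ℤ → Mat L) (m : ℤ) : Mat L := (jostPlus V 1 m)⁻¹ * jostMinus V 1 m

/-- The matrix, in the orthonormal families `(v_k)` (in `𝒩`) and `(e_i)` (in `ℒ`), of the operator
`P_ℒ (Ω^* + Γ) P_𝒩`. -/
def edgeMatrix {L d d' : ℕ} (V : ℤ → Mat L) (m : ℤ) (G : spaceN V →ₗ[ℂ] spaceL V)
    (v e : OrthonormalBasis (Fin d ⊕ Fin d') ℂ (Vec L)) : Matrix (Fin d) (Fin d) ℂ :=
  Matrix.of fun i k => inner ℂ (e (Sum.inl i))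
    ((spaceL V).starProjection
      (lin ((Omega V m)ᴴ + extendMat G) ((spaceN V).starProjection (v (Sum.inl k)))))

/-- The matrix whose columns are the vectors of the basis `v`. -/
def columnMat {L d d' : ℕ} (v : OrthonormalBasis (Fin d ⊕ Fin d') ℂ (Vec L)) :
    Matrix (Fin L) (Fin d ⊕ Fin d') ℂ :=
  Matrix.of fun i k => v k i

/-- `Q diag(2 A⁻¹, 0) P`, where `A` is the matrix of `P_ℒ (Ω^* + Γ) P_𝒩`, the columns of `Q` are
the vectors `v_k`, and the columns of `P^*` are the vectors `e_i`. -/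
def edgeTransmission {L d d' : ℕ} (V : ℤ → Mat L) (m : ℤ) (G : spaceN V →ₗ[ℂ] spaceL V)
    (v e : OrthonormalBasis (Fin d ⊕ Fin d') ℂ (Vec L)) : Mat L :=
  let D : Matrix (Fin d ⊕ Fin d') (Fin d ⊕ Fin d') ℂ :=
    Matrix.fromBlocks ((2 : ℂ) • (edgeMatrix V m G v e)⁻¹) 0 0 0
  columnMat v * D * (columnMat e)ᴴ

end MatrixSchrodinger

end

/-!
# The scattering matrix at the band edge

**Jost solutions.** `u_+^z(n) = z^n h(n, z)`, where `h` solves a Volterra equation whose kernel is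
bounded by `j ‖V(j)‖`; far to the right this is a contraction, uniformly and continuously in `z` up
to the unit circle (`exists_volterra_solution`). The reflection `n ↦ -n` (`reflect`) turns every
statement on `u_+` into one on `u_-`. Uniqueness, the relation `u_+^1 ξ = u_-^1 Γ ξ` on `𝒩` and the
connection formulas on the circle all come from one reduction-of-order argument
(`IsSolution.eq_mul_of_wronskianAt_eq_zero`): a solution whose Wronskian with an isotropic solution
vanishes is a right multiple of it.

**First order at `z = 1`.** With only a first moment, `u_+^z` need not be differentiable at `z = 1`,
but Wronskians of solutions at the two energies are: `W(u_+^1, u_+^z) = i (1 - z) (1 + o(1))`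
(`tendsto_wronskianAt_jostPlus_edge`). The Wronskian changes from site to site by
`O((1 - z)²)`, and after division by `i (1 - z) z^n` its recurrence is an averaging one, to which an
Abel summation applies (`tendsto_edge_of_average`). This covers tangential approach.

**Transmission.** At a site `m` with `u_+^1(m)` invertible put `K = u_+^1(m)⁻¹ u_+^z(m) → 1`. The
Wronskian `W(u_-^{1/z̄}, u_+^z) K⁻¹`, rescaled by `1 / (i (1 - z))` on `𝒩`, tends to
`Y = (Ω^* + Γ) P_𝒩 + W(u_-^1, u_+^1)` (`tendsto_rescaled_wronskian`). Since `Ω Γ ξ = ξ`, one has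
`⟨Γ ξ, (Ω^* + Γ) ξ⟩ = ‖ξ‖² + ‖Γ ξ‖²` (`inner_gamma`), which makes both `Y` and the block `A`
invertible. Hence `M_+^z` is invertible near `1` and `T_+^z → 2 P_𝒩 Y⁻¹` (`tendsto_TPlus`), from
which range, kernel and the block formula are read off. `T_-` follows from
`M_-^z = (M_+^{z̄})^*` (`MMinus_eq`), and the reflection coefficients from the connection formula
`u_-^{1/z} R_+ = u_-^z - u_+^z T_+` and its mirror image (`tendsto_reflection`).
-/

namespace MatrixSchrodinger

/-! ### The Volterra equation for the normalised Jost solution -/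

section Volterra

variable {𝔸 : Type*} [NormedRing 𝔸] [NormedAlgebra ℂ 𝔸]

/-- The Volterra kernel `z + z³ + ⋯ + z^(2k-1) = z^k (z^k - z^(-k)) / (z - z⁻¹)`, written as a
polynomial so that it also makes sense at `z = ±1`. -/
def volterraKernel (z : ℂ) (k : ℕ) : ℂ := ∑ i ∈ Finset.range k, z ^ (2 * i + 1)

theorem norm_volterraKernel_le {z : ℂ} (hz : ‖z‖ ≤ 1) (k : ℕ) : ‖volterraKernel z k‖ ≤ k := by
  refine (norm_sum_le_of_le _ fun i _ => ?_).trans_eq (by simp : ∑ i ∈ Finset.range k, (1 : ℝ) = k)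
  rw [norm_pow]
  exact pow_le_one₀ (norm_nonneg _) hz

theorem continuous_volterraKernel (k : ℕ) : Continuous fun z => volterraKernel z k := by
  unfold volterraKernel
  fun_prop

theorem norm_volterraTerm_le {z : ℂ} (hz : ‖z‖ ≤ 1) (v x : 𝔸) (n j : ℕ) :
    ‖volterraKernel z (j - n) • (v * x)‖ ≤ j * ‖v‖ * ‖x‖ := by
  rw [norm_smul, mul_assoc]
  refine mul_le_mul ((norm_volterraKernel_le hz _).trans ?_) (norm_mul_le _ _) (norm_nonneg _)
    (Nat.cast_nonneg _)
  exact_mod_cast Nat.sub_le _ _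

variable [CompleteSpace 𝔸]

/-- The Volterra equation is solved by a contraction on the bounded continuous functions of the
pair `(n, z)`, so that continuity in `z` up to the unit circle comes with existence. The sum may run
over all `j`, because the truncated subtraction `j - n` kills the terms with `j ≤ n`. -/
theorem exists_volterra_solution (v : ℕ → 𝔸) (hs : Summable fun j : ℕ => (j : ℝ) * ‖v j‖)
    (hlt : ∑' j : ℕ, (j : ℝ) * ‖v j‖ ≤ 1 / 2) :
    ∃ (h : ℕ → ℂ → 𝔸) (C : ℝ), (∀ n, ContinuousOn (h n) (Metric.closedBall 0 1)) ∧
      (∀ n z, ‖z‖ ≤ 1 → ‖h n z‖ ≤ C) ∧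
      ∀ n z, ‖z‖ ≤ 1 → h n z = 1 - ∑' j, volterraKernel z (j - n) • (v j * h j z) := by
  let X := BoundedContinuousFunction (ℕ × Metric.closedBall (0 : ℂ) 1) 𝔸
  have hz1 : ∀ z : Metric.closedBall (0 : ℂ) 1, ‖(z : ℂ)‖ ≤ 1 := fun z =>
    mem_closedBall_zero_iff.1 z.2
  have hbd : ∀ (f : X) (n : ℕ) (z : Metric.closedBall (0 : ℂ) 1) (j : ℕ),
      ‖volterraKernel z (j - n) • (v j * f (j, z))‖ ≤ j * ‖v j‖ * ‖f‖ := fun f n z j =>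
    (norm_volterraTerm_le (hz1 z) _ _ _ _).trans
      (mul_le_mul_of_nonneg_left (f.norm_coe_le_norm _) (by positivity))
  have hsum : ∀ (f : X) (n : ℕ) (z : Metric.closedBall (0 : ℂ) 1),
      Summable fun j => volterraKernel z (j - n) • (v j * f (j, z)) := fun f n z =>
    Summable.of_norm_bounded (hs.mul_right _) (hbd f n z)
  have hnorm : ∀ (f : X) (n : ℕ) (z : Metric.closedBall (0 : ℂ) 1),
      ‖∑' j, volterraKernel z (j - n) • (v j * f (j, z))‖ ≤ 1 / 2 * ‖f‖ := fun f n z => by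
    refine (tsum_of_norm_bounded (hs.mul_right ‖f‖).hasSum (hbd f n z)).trans ?_
    rw [tsum_mul_right]
    exact mul_le_mul_of_nonneg_right hlt (norm_nonneg _)
  let Φ : X → X := fun f => BoundedContinuousFunction.ofNormedAddCommGroup
    (fun p => 1 - ∑' j, volterraKernel p.2 (j - p.1) • (v j * f (j, p.2)))
    (by
      refine continuous_const.sub (continuous_tsum (fun j => ?_) (hs.mul_right ‖f‖)
        fun j p => hbd f p.1 p.2 j)
      refine Continuous.smul ?_ (by fun_prop)
      refine continuous_prod_of_discrete_left.2 fun n => ?_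
      exact (continuous_volterraKernel (j - n)).comp continuous_subtype_val)
    (‖(1 : 𝔸)‖ + 1 / 2 * ‖f‖)
    (fun p => (norm_sub_le _ _).trans (by gcongr; exact hnorm f p.1 p.2))
  have hΦ : ContractingWith (1 / 2) Φ := by
    refine ⟨by norm_num, LipschitzWith.of_dist_le_mul fun f g => ?_⟩
    rw [BoundedContinuousFunction.dist_le (by positivity)]
    intro p
    have e : Φ f p - Φ g p
        = -∑' j, volterraKernel p.2 (j - p.1) • (v j * (f - g) (j, p.2)) := by
      change (1 - ∑' j, volterraKernel p.2 (j - p.1) • (v j * f (j, p.2)))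
        - (1 - ∑' j, volterraKernel p.2 (j - p.1) • (v j * g (j, p.2))) = _
      rw [sub_sub_sub_cancel_left, ← (hsum g p.1 p.2).tsum_sub (hsum f p.1 p.2), ← tsum_neg]
      refine tsum_congr fun j => ?_
      rw [BoundedContinuousFunction.sub_apply, mul_sub, smul_sub, neg_sub]
    rw [dist_eq_norm, e, norm_neg, dist_eq_norm]
    simpa using hnorm (f - g) p.1 p.2
  let F : X := hΦ.fixedPoint
  have hF : Φ F = F := hΦ.fixedPoint_isFixedPt
  refine ⟨fun n z => if hz : ‖z‖ ≤ 1 then F (n, ⟨z, by simpa using hz⟩) else 0, ‖F‖, ?_, ?_, ?_⟩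
  · intro n
    rw [continuousOn_iff_continuous_domRestrict]
    have : Continuous fun z : Metric.closedBall (0 : ℂ) 1 => F (n, z) := by fun_prop
    refine this.congr fun z => ?_
    simp [hz1 z]
  · intro n z hz
    simp only [hz, dif_pos]
    exact F.norm_coe_le_norm _
  · intro n z hz
    simp only [hz, dif_pos]
    conv_lhs => rw [← hF]
    rfl

theorem volterraKernel_succ (z : ℂ) (k : ℕ) :
    volterraKernel z (k + 1) = z + z ^ 2 * volterraKernel z k := by
  simp only [volterraKernel, Finset.sum_range_succ', Finset.mul_sum]
  rw [add_comm]
  congr 1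
  · ring
  · exact Finset.sum_congr rfl fun i _ => by ring

/-- As a function of `n`, the kernel `z^(n-j) volterraKernel z (j - n)` is a Green function of the
free operator; here with the powers of `z` cleared. -/
theorem volterraKernel_second_difference (z : ℂ) (n j : ℕ) :
    (1 + z ^ 2) * volterraKernel z (j - (n + 1)) - z ^ 2 * volterraKernel z (j - (n + 2))
      - volterraKernel z (j - n) = if j = n + 1 then -z else 0 := by
  have h0 : volterraKernel z 0 = 0 := by simp [volterraKernel]
  rcases le_or_gt j n with h | h
  · have h1 : j - (n + 1) = 0 := by omega
    have h2 : j - (n + 2) = 0 := by omega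
    have h3 : j - n = 0 := by omega
    rw [h1, h2, h3, h0, if_neg (by omega)]
    ring
  · obtain ⟨k, rfl⟩ := Nat.exists_eq_add_of_lt h
    rcases k with _ | k
    · have h1 : n + 0 + 1 - (n + 1) = 0 := by omega
      have h2 : n + 0 + 1 - (n + 2) = 0 := by omega
      have h3 : n + 0 + 1 - n = 0 + 1 := by omega
      rw [h1, h2, h3, volterraKernel_succ, h0, if_pos (by omega)]
      ring
    · have h1 : n + (k + 1) + 1 - (n + 1) = k + 1 := by omega
      have h2 : n + (k + 1) + 1 - (n + 2) = k := by omega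
      have h3 : n + (k + 1) + 1 - n = k + 1 + 1 := by omega
      rw [h1, h2, h3, volterraKernel_succ z (k + 1), volterraKernel_succ, if_neg (by omega)]
      ring

theorem norm_volterraKernel_sub_le {z : ℂ} (hz : ‖z‖ ≤ 1) (n j : ℕ) :
    ‖volterraKernel z (j - n) - volterraKernel z (j - (n + 1))‖ ≤ if n < j then 1 else 0 := by
  split_ifs with h
  · have h3 : j - n = j - (n + 1) + 1 := by omega
    rw [h3, volterraKernel, volterraKernel, Finset.sum_range_succ, add_sub_cancel_left, norm_pow]
    exact pow_le_one₀ (norm_nonneg _) hz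
  · have h1 : j - (n + 1) = 0 := by omega
    have h3 : j - n = 0 := by omega
    simp [h1, h3]

theorem summable_tail {a : ℕ → ℝ} (ha : ∀ j, 0 ≤ a j) (hs : Summable fun j : ℕ => (j : ℝ) * a j)
    (n : ℕ) : Summable fun j => if n < j then a j else 0 := by
  refine hs.of_nonneg_of_le (fun j => by split_ifs <;> simp [ha]) fun j => ?_
  split_ifs with h
  · exact le_mul_of_one_le_left (ha j) (by exact_mod_cast (by omega : 1 ≤ j))
  · exact mul_nonneg (Nat.cast_nonneg _) (ha j)

/-- The tails of a sequence with finite first moment are summable. -/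
theorem summable_tsum_tail {a : ℕ → ℝ} (ha : ∀ j, 0 ≤ a j)
    (hs : Summable fun j : ℕ => (j : ℝ) * a j) :
    Summable fun n : ℕ => ∑' j, if n < j then a j else 0 := by
  have h0 : ∀ p : ℕ × ℕ, 0 ≤ (if p.2 < p.1 then a p.1 else 0) := fun p => by
    split_ifs <;> simp [ha]
  have hfin : ∀ j, HasSum (fun n => if n < j then a j else 0) ((j : ℝ) * a j) := fun j => by
    have : HasSum (fun n => if n < j then a j else 0)
        (∑ n ∈ Finset.range j, if n < j then a j else 0) :=
      hasSum_sum_of_ne_finset_zero fun n hn => if_neg (by simpa using hn)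
    convert this using 1
    rw [Finset.sum_ite_of_true (fun n hn => Finset.mem_range.1 hn)]
    simp
  have hp : Summable fun p : ℕ × ℕ => if p.2 < p.1 then a p.1 else 0 :=
    (summable_prod_of_nonneg h0).2 ⟨fun j => (hfin j).summable, by
      simpa only [(hfin _).tsum_eq] using hs⟩
  exact hp.prod_symm.prod

theorem tendsto_mul_tsum_tail {a : ℕ → ℝ} (ha : ∀ j, 0 ≤ a j)
    (hs : Summable fun j : ℕ => (j : ℝ) * a j) :
    Tendsto (fun n : ℕ => (n : ℝ) * ∑' j, if n < j then a j else 0) atTop (𝓝 0) := by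
  have h : Tendsto (fun n : ℕ => ∑' j, (n : ℝ) * if n < j then a j else 0) atTop
      (𝓝 (∑' _ : ℕ, (0 : ℝ))) := by
    refine tendsto_tsum_of_dominated_convergence hs (fun j => ?_) (Eventually.of_forall ?_)
    · refine tendsto_const_nhds.congr' ?_
      filter_upwards [eventually_ge_atTop j] with n hn
      simp [hn]
    · intro n j
      rw [Real.norm_of_nonneg (by split_ifs <;> simp [ha, mul_nonneg])]
      split_ifs with h
      · exact mul_le_mul_of_nonneg_right (by exact_mod_cast h.le) (ha j)
      · simpa using mul_nonneg (Nat.cast_nonneg j) (ha j)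
  simpa only [tsum_mul_left, tsum_zero] using h

/-- The normalised Jost solutions `h n z = z^(-n) u_+^z(n)` on a half-line, with a majorant of
their increments which is uniform in `z`, summable, and `o(1/n)`. -/
theorem exists_normalized_jost (v : ℕ → 𝔸) (hs : Summable fun j : ℕ => (j : ℝ) * ‖v j‖)
    (hlt : ∑' j : ℕ, (j : ℝ) * ‖v j‖ ≤ 1 / 2) :
    ∃ (h : ℕ → ℂ → 𝔸) (β : ℕ → ℝ) (C : ℝ), Summable β ∧
      Tendsto (fun n : ℕ => (n : ℝ) * β n) atTop (𝓝 0) ∧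
      (∀ n, ContinuousOn (h n) (Metric.closedBall 0 1)) ∧
      (∀ n z, ‖z‖ ≤ 1 → ‖h n z‖ ≤ C) ∧
      (∀ n z, ‖z‖ ≤ 1 → ‖h (n + 1) z - h n z‖ ≤ β n) ∧
      (∀ z, ‖z‖ ≤ 1 → Tendsto (fun n => h n z) atTop (𝓝 1)) ∧
      (∀ n z, ‖z‖ ≤ 1 →
        z ^ 2 • h (n + 2) z + h n z + z • (v (n + 1) * h (n + 1) z)
          = (1 + z ^ 2) • h (n + 1) z) := by
  obtain ⟨h, C, hcont, hC, heq⟩ := exists_volterra_solution v hs hlt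
  have hle : ∀ n z, ‖z‖ ≤ 1 → ∀ j,
      ‖volterraKernel z (j - n) • (v j * h j z)‖ ≤ j * ‖v j‖ * C := fun n z hz j =>
    (norm_volterraTerm_le hz _ _ _ _).trans (by gcongr; exact hC j z hz)
  have hsum : ∀ n z, ‖z‖ ≤ 1 →
      Summable fun j => volterraKernel z (j - n) • (v j * h j z) := fun n z hz =>
    Summable.of_norm_bounded (hs.mul_right C) (hle n z hz)
  have hC0 : 0 ≤ C := (norm_nonneg _).trans (hC 0 0 (by simp))
  refine ⟨h, fun n => (∑' j, if n < j then ‖v j‖ else 0) * C, C,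
    (summable_tsum_tail (fun _ => norm_nonneg _) hs).mul_right C, ?_, hcont, hC, ?_, ?_, ?_⟩
  · simpa [mul_assoc] using
      (tendsto_mul_tsum_tail (a := fun j => ‖v j‖) (fun _ => norm_nonneg _) hs).mul_const C
  · intro n z hz
    rw [heq n z hz, heq (n + 1) z hz, sub_sub_sub_cancel_left,
      ← (hsum n z hz).tsum_sub (hsum (n + 1) z hz)]
    refine tsum_of_norm_bounded
      ((summable_tail (fun j => norm_nonneg (v j)) hs n).hasSum.mul_right C) fun j => ?_
    rw [← sub_smul, norm_smul]
    calc _ ≤ (if n < j then (1 : ℝ) else 0) * (‖v j‖ * C) := by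
          refine mul_le_mul (norm_volterraKernel_sub_le hz n j) ((norm_mul_le _ _).trans ?_)
            (norm_nonneg _) (by split_ifs <;> norm_num)
          gcongr
          exact hC j z hz
      _ = _ := by split_ifs <;> simp
  · intro z hz
    have : Tendsto (fun n => ∑' j, volterraKernel z (j - n) • (v j * h j z)) atTop
        (𝓝 (∑' _ : ℕ, (0 : 𝔸))) := by
      refine tendsto_tsum_of_dominated_convergence (hs.mul_right C) (fun j => ?_)
        (Eventually.of_forall fun n j => hle n z hz j)
      refine tendsto_const_nhds.congr' ?_
      filter_upwards [eventually_ge_atTop j] with n hn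
      simp [Nat.sub_eq_zero_of_le hn, volterraKernel]
    have h1 := (tendsto_const_nhds (x := (1 : 𝔸))).sub this
    rw [tsum_zero, sub_zero] at h1
    exact h1.congr fun n => (heq n z hz).symm
  · intro n z hz
    have key : (1 + z ^ 2) • (∑' j, volterraKernel z (j - (n + 1)) • (v j * h j z))
        - z ^ 2 • (∑' j, volterraKernel z (j - (n + 2)) • (v j * h j z))
        - (∑' j, volterraKernel z (j - n) • (v j * h j z)) = -(z • (v (n + 1) * h (n + 1) z)) := by
      rw [← (hsum (n + 1) z hz).tsum_const_smul, ← (hsum (n + 2) z hz).tsum_const_smul,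
        ← ((hsum (n + 1) z hz).const_smul _).tsum_sub ((hsum (n + 2) z hz).const_smul _),
        ← (((hsum (n + 1) z hz).const_smul _).sub ((hsum (n + 2) z hz).const_smul _)).tsum_sub
          (hsum n z hz), tsum_eq_single (n + 1)]
      · rw [smul_smul, smul_smul, ← sub_smul, ← sub_smul, volterraKernel_second_difference,
          if_pos rfl, neg_smul]
      · intro j hj
        rw [smul_smul, smul_smul, ← sub_smul, ← sub_smul, volterraKernel_second_difference,
          if_neg hj, zero_smul]
    have e1 := heq (n + 1) z hz
    have e2 := heq (n + 2) z hz
    have e0 := heq n z hz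
    generalize (∑' j, volterraKernel z (j - (n + 1)) • (v j * h j z)) = s1 at *
    generalize (∑' j, volterraKernel z (j - (n + 2)) • (v j * h j z)) = s2 at *
    generalize (∑' j, volterraKernel z (j - n) • (v j * h j z)) = s0 at *
    rw [← neg_eq_iff_eq_neg] at key
    rw [← key]
    rw [e0, e1, e2]
    module

end Volterra

/-! ### Solutions, Wronskians and the reflection of `ℤ` -/

section Solutions

variable {L : ℕ} {V : ℤ → Mat L} {z : ℂ}

theorem IsSolution.sub {u v : ℤ → Mat L} (hu : IsSolution V z u) (hv : IsSolution V z v) :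
    IsSolution V z (u - v) := fun n => by
  have h1 := hu n
  have h2 := hv n
  simp only [hamiltonian, Pi.sub_apply, mul_sub, smul_sub] at *
  rw [← h1, ← h2]
  abel

theorem IsSolution.add {u v : ℤ → Mat L} (hu : IsSolution V z u) (hv : IsSolution V z v) :
    IsSolution V z (u + v) := fun n => by
  have h1 := hu n
  have h2 := hv n
  simp only [hamiltonian, Pi.add_apply, mul_add, smul_add] at *
  rw [← h1, ← h2]
  abel

theorem IsSolution.mul_right {u : ℤ → Mat L} (hu : IsSolution V z u) (c : Mat L) :
    IsSolution V z fun n => u n * c := fun n => by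
  have h1 := hu n
  simp only [hamiltonian] at *
  rw [← Matrix.smul_mul, ← h1, add_mul, add_mul, mul_assoc]

theorem IsSolution.inv {u : ℤ → Mat L} (hu : IsSolution V z u) : IsSolution V z⁻¹ u := fun n => by
  rw [hu n, inv_inv, add_comm]

theorem isSolution_inv_iff {u : ℤ → Mat L} : IsSolution V z⁻¹ u ↔ IsSolution V z u :=
  ⟨fun h => by simpa using h.inv, IsSolution.inv⟩

theorem IsSolution.apply_add_one {u : ℤ → Mat L} (hu : IsSolution V z u) (n : ℤ) :
    u (n + 1) = (z + z⁻¹) • u n - V n * u n - u (n - 1) := by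
  rw [← hu n, hamiltonian]
  abel

theorem IsSolution.apply_sub_one {u : ℤ → Mat L} (hu : IsSolution V z u) (n : ℤ) :
    u (n - 1) = (z + z⁻¹) • u n - V n * u n - u (n + 1) := by
  rw [← hu n, hamiltonian]
  abel

/-- A solution is determined by its values at two consecutive sites. -/
theorem IsSolution.eq_of_eq {u v : ℤ → Mat L} (hu : IsSolution V z u) (hv : IsSolution V z v)
    {n : ℤ} (h0 : u n = v n) (h1 : u (n + 1) = v (n + 1)) (k : ℤ) : u k = v k := by
  have : u k = v k ∧ u (k + 1) = v (k + 1) := by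
    induction k using Int.inductionOn' (b := n) with
    | zero => exact ⟨h0, h1⟩
    | succ k _ ih =>
      refine ⟨ih.2, ?_⟩
      rw [hu.apply_add_one, hv.apply_add_one, add_sub_cancel_right, ih.1, ih.2]
    | pred k _ ih =>
      rw [sub_add_cancel]
      refine ⟨?_, ih.1⟩
      rw [hu.apply_sub_one, hv.apply_sub_one, ih.1, ih.2]
  exact this.1

/-- The Cauchy problem for `H u = (z + 1/z) u` is solvable from any pair of consecutive sites. -/
theorem exists_isSolution (V : ℤ → Mat L) (z : ℂ) (N : ℤ) (a b : Mat L) :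
    ∃ u, IsSolution V z u ∧ u N = a ∧ u (N + 1) = b := by
  let r : ℕ → Mat L × Mat L := fun k => Nat.rec (a, b)
    (fun k p => (p.2, (z + z⁻¹) • p.2 - V (N + k + 1) * p.2 - p.1)) k
  let l : ℕ → Mat L × Mat L := fun k => Nat.rec (a, b)
    (fun k p => ((z + z⁻¹) • p.1 - V (N - k) * p.1 - p.2, p.1)) k
  have hr : ∀ k, r (k + 1) = ((r k).2, (z + z⁻¹) • (r k).2 - V (N + k + 1) * (r k).2 - (r k).1) :=
    fun _ => rfl
  have hl : ∀ k, l (k + 1) = ((z + z⁻¹) • (l k).1 - V (N - k) * (l k).1 - (l k).2, (l k).1) :=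
    fun _ => rfl
  -- The pairs `r k` are the values at `N + k, N + k + 1`, and `l k` those at `N - k, N - k + 1`.
  let w : ℤ → Mat L := fun n => if 0 ≤ n then (r n.toNat).1 else (l (-n).toNat).1
  have hwp : ∀ k : ℕ, w k = (r k).1 := fun k => by simp [w]
  have hwm : ∀ k : ℕ, w (-k) = (l k).1 := fun k => by
    rcases k with _ | k
    · rfl
    · have : ¬ (0 : ℤ) ≤ -((k + 1 : ℕ) : ℤ) := by omega
      simp only [w, if_neg this, neg_neg, Int.toNat_natCast]
  have hw1 : w 1 = b := hwp 1
  have key : ∀ n : ℤ, w (n + 1) + w (n - 1) + V (N + n) * w n = (z + z⁻¹) • w n := by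
    intro n
    obtain ⟨k, rfl | rfl⟩ := n.eq_nat_or_neg
    · rcases k with _ | k
      · have h1 := hwm 1
        have h0 := hwp 0
        simp only [hl, Nat.cast_zero, Nat.cast_one, sub_zero, zero_add, zero_sub, add_zero] at *
        have : (l 0).1 = (r 0).1 := rfl
        rw [h1, h0, hw1, this]
        change b + (_ - b) + _ = _
        abel
      · have h0 := hwp k
        have h1 := hwp (k + 1)
        have h2 := hwp (k + 2)
        rw [show ((k + 1 : ℕ) : ℤ) - 1 = k by omega,
          show ((k + 1 : ℕ) : ℤ) + 1 = (k + 2 : ℕ) by omega, h0, h1, h2, hr (k + 1), hr k]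
        push_cast
        rw [add_assoc N]
        abel
    · rcases k with _ | k
      · have h1 := hwm 1
        have h0 := hwp 0
        simp only [hl, Nat.cast_zero, Nat.cast_one, sub_zero, zero_add, zero_sub, add_zero,
          neg_zero] at *
        have : (l 0).1 = (r 0).1 := rfl
        rw [h1, h0, hw1, this]
        change b + (_ - b) + _ = _
        abel
      · have h0 := hwm k
        have h1 := hwm (k + 1)
        have h2 := hwm (k + 2)
        rw [show -((k + 1 : ℕ) : ℤ) + 1 = -(k : ℤ) by omega,
          show -((k + 1 : ℕ) : ℤ) - 1 = -((k + 2 : ℕ) : ℤ) by omega, h0, h1, h2, hl (k + 1), hl k]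
        push_cast
        rw [← sub_eq_add_neg N]
        abel
  refine ⟨fun n => w (n - N), fun n => ?_, ?_, ?_⟩
  · have := key (n - N)
    simp only [hamiltonian]
    rwa [show n + 1 - N = n - N + 1 by ring, show n - 1 - N = n - N - 1 by ring,
      show V n = V (N + (n - N)) by congr 1; ring]
  · change w (N - N) = a
    rw [sub_self]
    exact hwp 0
  · simpa using hw1

theorem conjTranspose_wronskianAt (u v : ℤ → Mat L) (n : ℤ) :
    (wronskianAt u v n)ᴴ = wronskianAt v u n := by
  simp only [wronskianAt, Matrix.conjTranspose_smul, Matrix.conjTranspose_sub,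
    Matrix.conjTranspose_mul, Matrix.conjTranspose_conjTranspose, Complex.star_def, Complex.conj_I,
    neg_smul, ← smul_neg, neg_sub]

theorem wronskianAt_mul_right (u v : ℤ → Mat L) (c : Mat L) (n : ℤ) :
    wronskianAt u (fun k => v k * c) n = wronskianAt u v n * c := by
  simp only [wronskianAt, Matrix.smul_mul, sub_mul, mul_assoc]

theorem wronskianAt_sub_right (u v w : ℤ → Mat L) (n : ℤ) :
    wronskianAt u (v - w) n = wronskianAt u v n - wronskianAt u w n := by
  simp only [wronskianAt, Pi.sub_apply, mul_sub, smul_sub]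
  abel

theorem wronskianAt_add_right (u v w : ℤ → Mat L) (n : ℤ) :
    wronskianAt u (v + w) n = wronskianAt u v n + wronskianAt u w n := by
  simp only [wronskianAt, Pi.add_apply, mul_add, smul_add, smul_sub]
  abel

/-- Reduction of order: if `u` pairs to zero with the solutions `v` and `w` and both `u` and `v`
are invertible at some site, then `w` is a right multiple of `v`. -/
theorem IsSolution.eq_mul_of_wronskianAt_eq_zero {u v w : ℤ → Mat L} (hv : IsSolution V z v)
    (hw : IsSolution V z w) {n : ℤ} (hun : IsUnit (u n)) (hvn : IsUnit (v n))
    (huv : wronskianAt u v n = 0) (huw : wronskianAt u w n = 0) (k : ℤ) :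
    w k = v k * ((v n)⁻¹ * w n) := by
  have hvn' := (Matrix.isUnit_iff_isUnit_det _).1 hvn
  have hu' : IsUnit (u n)ᴴ := hun.star
  rw [wronskianAt, smul_eq_zero_iff_right Complex.I_ne_zero, sub_eq_zero] at huv huw
  refine hw.eq_of_eq (hv.mul_right _) (n := n) ?_ ?_ k
  · rw [← mul_assoc, Matrix.mul_nonsing_inv _ hvn', one_mul]
  · refine hu'.mul_left_cancel ?_
    rw [← huw, ← mul_assoc, ← huv, mul_assoc, ← mul_assoc (v n), Matrix.mul_nonsing_inv _ hvn',
      one_mul]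

/-- The reflection `n ↦ -n` of a sequence. It exchanges the two ends of `ℤ`. -/
def reflect (u : ℤ → Mat L) : ℤ → Mat L := fun n => u (-n)

@[simp] theorem reflect_apply (u : ℤ → Mat L) (n : ℤ) : reflect u n = u (-n) := rfl

@[simp] theorem reflect_reflect (u : ℤ → Mat L) : reflect (reflect u) = u := by
  funext n
  simp

theorem IsSolution.reflect {u : ℤ → Mat L} (hu : IsSolution V z u) :
    IsSolution (reflect V) z (MatrixSchrodinger.reflect u) := fun n => by
  have := hu (-n)
  simp only [hamiltonian, reflect_apply] at *
  rw [show -(n + 1) = -n - 1 by ring, show -(n - 1) = -n + 1 by ring, ← this]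
  abel

theorem wronskianAt_reflect (u v : ℤ → Mat L) (n : ℤ) :
    wronskianAt (reflect u) (reflect v) n = -wronskianAt u v (-n - 1) := by
  simp only [wronskianAt, reflect_apply]
  rw [show -(n + 1) = -n - 1 by ring, sub_add_cancel, ← smul_neg, neg_sub]

theorem IsJostPlus.reflect {u : ℤ → Mat L} (hu : IsJostPlus V z u) :
    IsJostMinus (reflect V) z⁻¹ (MatrixSchrodinger.reflect u) := by
  refine ⟨hu.1.reflect.inv, (hu.2.comp tendsto_neg_atBot_atTop).congr fun n => ?_⟩
  simp

theorem IsJostMinus.reflect {u : ℤ → Mat L} (hu : IsJostMinus V z⁻¹ u) :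
    IsJostPlus (reflect V) z (MatrixSchrodinger.reflect u) := by
  refine ⟨(isSolution_inv_iff.1 hu.1).reflect,
    (hu.2.comp tendsto_neg_atTop_atBot).congr fun n => ?_⟩
  simp

theorem isHermitian_reflect (hV : ∀ n, (V n).IsHermitian) (n : ℤ) : (reflect V n).IsHermitian :=
  hV _

theorem FiniteFirstMoment.reflect (hV : FiniteFirstMoment V) :
    FiniteFirstMoment (reflect V) := by
  have := ((Equiv.neg ℤ).summable_iff (f := fun n : ℤ =>
    ‖Matrix.toEuclideanCLM (𝕜 := ℂ) ((n : ℂ) • V n)‖)).2 hV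
  refine this.congr fun n => ?_
  simp only [Function.comp_apply, Equiv.neg_apply, MatrixSchrodinger.reflect_apply, map_smul,
    norm_smul, Int.cast_neg, norm_neg]

theorem tendsto_atTop_int_of_nat {α : Type*} {f : ℤ → α} {l : Filter α} (N : ℤ)
    (hf : Tendsto (fun n : ℕ => f (N + n)) atTop l) : Tendsto f atTop l := by
  have : Tendsto (fun k : ℤ => (k - N).toNat) atTop atTop := tendsto_atTop.2 fun b => by
    filter_upwards [eventually_ge_atTop (N + b)] with k hk
    omega
  refine (hf.comp this).congr' ?_
  filter_upwards [eventually_ge_atTop N] with k hk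
  simp only [Function.comp_apply]
  congr 1
  omega

end Solutions

/-! ### Existence and uniqueness of the Jost solutions -/

section JostExistence

open scoped Matrix.Norms.L2Operator

variable {L : ℕ} {V : ℤ → Mat L} {z : ℂ}

theorem FiniteFirstMoment.summable_norm (hmom : FiniteFirstMoment V) :
    Summable fun n : ℤ => |(n : ℝ)| * ‖V n‖ := by
  refine Summable.congr hmom fun n => ?_
  rw [Matrix.l2_opNorm_toEuclideanCLM, norm_smul, Complex.norm_intCast]

/-- Existence of the Jost solution `u_+^z`, with its representation on a half-line by the normalised
solution `h n z`, which is estimated uniformly in `z`. -/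
theorem exists_isJostPlus (hmom : FiniteFirstMoment V) :
    ∃ (N : ℕ) (h : ℕ → ℂ → Mat L) (β : ℕ → ℝ) (C : ℝ), Summable β ∧
      Tendsto (fun n : ℕ => (n : ℝ) * β n) atTop (𝓝 0) ∧
      (∀ n, ContinuousOn (h n) (Metric.closedBall 0 1)) ∧
      (∀ n z, ‖z‖ ≤ 1 → ‖h n z‖ ≤ C) ∧
      (∀ n z, ‖z‖ ≤ 1 → ‖h (n + 1) z - h n z‖ ≤ β n) ∧
      (∀ z, ‖z‖ ≤ 1 → Tendsto (fun n => h n z) atTop (𝓝 1)) ∧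
      ∀ z, z ≠ 0 → ‖z‖ ≤ 1 → ∃ u, IsJostPlus V z u ∧
        ∀ n : ℕ, u (N + n) = z ^ ((N : ℤ) + n) • h n z := by
  have hs : Summable fun n : ℕ => (n : ℝ) * ‖V n‖ := by
    simpa [Function.comp_def] using
      hmom.summable_norm.comp_injective (i := ((↑) : ℕ → ℤ)) Nat.cast_injective
  obtain ⟨N, hN⟩ := ((tendsto_sum_nat_add fun n : ℕ => (n : ℝ) * ‖V n‖).eventually_le_const
    (by norm_num : (0 : ℝ) < 1 / 2)).exists
  -- Far enough to the right the Volterra operator is a contraction; the solution obtained there is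
  -- continued to all of `ℤ` by the recurrence.
  have hs' := (summable_nat_add_iff N).2 hs
  have hle : ∀ j : ℕ, (j : ℝ) * ‖V (N + j)‖ ≤ ((j + N : ℕ) : ℝ) * ‖V ((j + N : ℕ) : ℤ)‖ := by
    intro j
    rw [show ((j + N : ℕ) : ℤ) = N + j by push_cast; ring]
    exact mul_le_mul_of_nonneg_right (by push_cast; simp) (norm_nonneg _)
  have hs1 : Summable fun j : ℕ => (j : ℝ) * ‖V (N + j)‖ :=
    hs'.of_nonneg_of_le (fun j => by positivity) hle
  obtain ⟨h, β, C, h1, h2, h3, h4, h5, h6, h7⟩ := exists_normalized_jost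
    (fun j : ℕ => V (N + j)) hs1 ((hs1.tsum_le_tsum hle hs').trans hN)
  refine ⟨N, h, β, C, h1, h2, h3, h4, h5, h6, fun z hz0 hz => ?_⟩
  obtain ⟨u, hu, hu0, hu1⟩ := exists_isSolution V z N (z ^ (N : ℤ) • h 0 z)
    (z ^ ((N : ℤ) + 1) • h 1 z)
  have hval : ∀ n : ℕ, u (N + n) = z ^ ((N : ℤ) + n) • h n z ∧
      u (N + n + 1) = z ^ ((N : ℤ) + n + 1) • h (n + 1) z := by
    intro n
    induction n with
    | zero => simpa using ⟨hu0, hu1⟩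
    | succ n ih =>
      have e : (N : ℤ) + (n + 1 : ℕ) = N + n + 1 := by push_cast; ring
      rw [e]
      refine ⟨ih.2, ?_⟩
      have h7' := h7 n z hz
      simp only [Nat.cast_add, Nat.cast_one, ← add_assoc] at h7'
      have e2 : z ^ 2 • h (n + 2) z
          = (1 + z ^ 2) • h (n + 1) z - z • (V (N + n + 1) * h (n + 1) z) - h n z := by
        rw [← h7']
        abel
      have e3 : z ^ ((N : ℤ) + n + 1 + 1) = z ^ ((N : ℤ) + n) * z ^ 2 := by
        rw [zpow_add_one₀ hz0, zpow_add_one₀ hz0]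
        ring
      rw [hu.apply_add_one, ih.2, add_sub_cancel_right, ih.1, e3, mul_smul, e2, Matrix.mul_smul,
        zpow_add_one₀ hz0]
      simp only [smul_sub, smul_smul]
      congr 3
      field_simp
      ring
  refine ⟨u, ⟨hu, tendsto_atTop_int_of_nat N ?_⟩, fun n => (hval n).1⟩
  refine (h6 z hz).congr fun n => ?_
  rw [(hval n).1, smul_smul, inv_mul_cancel₀ (zpow_ne_zero _ hz0), one_smul]

/-- A Jost solution at the conjugate energy has vanishing Wronskian with every solution that is
`z^n (b + o(1))` at `+∞`, also for `|z| = 1`: both leading terms of the Wronskian equal `b`. -/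
theorem wronskianAt_eq_zero_of_tendsto (hV : ∀ n, (V n).IsHermitian) (hz0 : z ≠ 0) (hz : ‖z‖ ≤ 1)
    {u v : ℤ → Mat L} {b : Mat L} (hu : IsJostPlus V (star z) u) (hv : IsSolution V z v)
    (hvb : Tendsto (fun n : ℤ => (z ^ n)⁻¹ • v n) atTop (𝓝 b)) (n : ℤ) : wronskianAt u v n = 0 := by
  set f : ℤ → Mat L := fun n => (star z ^ n)⁻¹ • u n
  set g : ℤ → Mat L := fun n => (z ^ n)⁻¹ • v n
  have hsz : star z ≠ 0 := star_ne_zero.2 hz0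
  have hf : Tendsto f atTop (𝓝 1) := hu.2
  have ht : Tendsto (fun n : ℤ => n + 1) atTop atTop := tendsto_atTop_add_const_right _ _ tendsto_id
  have hlim : Tendsto (fun n => (f (n + 1))ᴴ * g n - (f n)ᴴ * g (n + 1)) atTop (𝓝 0) := by
    have h1 : Tendsto (fun n => (f n)ᴴ) atTop (𝓝 1) := by
      simpa only [Matrix.star_eq_conjTranspose, Matrix.conjTranspose_one] using hf.star
    simpa using ((h1.comp ht).mul hvb).sub (h1.mul (hvb.comp ht))
  have hform : ∀ n, wronskianAt u v n
      = (Complex.I * z ^ (2 * n + 1)) • ((f (n + 1))ᴴ * g n - (f n)ᴴ * g (n + 1)) := by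
    intro n
    have e1 : ∀ n, (u n)ᴴ = z ^ n • (f n)ᴴ := fun n => by
      simp only [f, Matrix.conjTranspose_smul, star_inv₀, star_zpow₀, star_star]
      rw [smul_smul, mul_inv_cancel₀ (zpow_ne_zero _ hz0), one_smul]
    have e2 : ∀ n, v n = z ^ n • g n := fun n => by
      simp only [g]
      rw [smul_smul, mul_inv_cancel₀ (zpow_ne_zero _ hz0), one_smul]
    simp only [wronskianAt, e1, e2 n, e2 (n + 1), Matrix.smul_mul, Matrix.mul_smul, smul_smul,
      smul_sub]
    rw [← zpow_add₀ hz0, ← zpow_add₀ hz0, show n + (n + 1) = 2 * n + 1 by ring,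
      show n + 1 + n = 2 * n + 1 by ring]
  have h0 : Tendsto (fun n => wronskianAt u v n) atTop (𝓝 0) := by
    refine squeeze_zero_norm' ?_ (tendsto_zero_iff_norm_tendsto_zero.1 hlim)
    filter_upwards [eventually_ge_atTop 0] with n hn
    lift n to ℕ using hn
    rw [hform, norm_smul, norm_mul, Complex.norm_I, one_mul,
      show (2 * (n : ℤ) + 1) = ((2 * n + 1 : ℕ) : ℤ) by push_cast; ring, zpow_natCast, norm_pow]
    exact mul_le_of_le_one_left (norm_nonneg _) (pow_le_one₀ (norm_nonneg _) hz)
  have hc : Tendsto (fun n => wronskianAt u v n) atTop (𝓝 (wronskianAt u v 0)) :=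
    tendsto_const_nhds.congr fun n => (wronskianAt_eq hV hu.1 hv n).symm
  rw [wronskianAt_eq hV hu.1 hv, tendsto_nhds_unique hc h0]

theorem eventually_isUnit_of_tendsto_one {ι : Type*} {l : Filter ι} {f : ι → Mat L}
    (hf : Tendsto f l (𝓝 1)) : ∀ᶠ i in l, IsUnit (f i) :=
  hf.eventually (Units.isOpen.mem_nhds isUnit_one)

theorem IsJostPlus.eventually_isUnit {u : ℤ → Mat L} (hz0 : z ≠ 0) (hu : IsJostPlus V z u) :
    ∀ᶠ n : ℤ in atTop, IsUnit (u n) := by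
  filter_upwards [eventually_isUnit_of_tendsto_one hu.2] with n hn
  have h0 : (z ^ n)⁻¹ ≠ 0 := inv_ne_zero (zpow_ne_zero _ hz0)
  have := hn.smul (Units.mk0 _ h0)⁻¹
  rwa [Units.smul_def, Units.val_inv_eq_inv_val, Units.val_mk0, smul_smul, inv_mul_cancel₀ h0,
    one_smul] at this

/-- Uniqueness: the difference of two Jost solutions is a right multiple `u c` of one of them, by
reduction of order, and `c = 0` by comparing the limits. -/
theorem existsUnique_isJostPlus (hV : ∀ n, (V n).IsHermitian) (hmom : FiniteFirstMoment V)
    (hz0 : z ≠ 0) (hz : ‖z‖ ≤ 1) : ∃! u, IsJostPlus V z u := by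
  obtain ⟨N, h, β, C, -, -, -, -, -, -, hex⟩ := exists_isJostPlus hmom
  have hsz0 : star z ≠ 0 := star_ne_zero.2 hz0
  have hsz : ‖star z‖ ≤ 1 := by rwa [norm_star]
  obtain ⟨u, hu, -⟩ := hex z hz0 hz
  obtain ⟨v, hv, -⟩ := hex (star z) hsz0 hsz
  refine ⟨u, hu, fun w hw => ?_⟩
  have hd : IsSolution V z (w - u) := hw.1.sub hu.1
  have hdt : Tendsto (fun n : ℤ => (z ^ n)⁻¹ • (w - u) n) atTop (𝓝 0) := by
    simpa [smul_sub] using hw.2.sub hu.2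
  obtain ⟨n, hn1, hn2⟩ := (hv.eventually_isUnit hsz0 |>.and (hu.eventually_isUnit hz0)).exists
  set c := (u n)⁻¹ * (w - u) n
  have hc : ∀ k, (w - u) k = u k * c := hu.1.eq_mul_of_wronskianAt_eq_zero hd hn1 hn2
    (wronskianAt_eq_zero_of_tendsto hV hz0 hz hv hu.1 hu.2 n)
    (wronskianAt_eq_zero_of_tendsto hV hz0 hz hv hd hdt n)
  have hct : Tendsto (fun n : ℤ => (z ^ n)⁻¹ • (w - u) n) atTop (𝓝 (1 * c)) :=
    (hu.2.mul_const c).congr fun k => by rw [hc, Matrix.smul_mul]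
  have hc0 : c = 0 := by simpa using tendsto_nhds_unique hct hdt
  funext k
  rw [← sub_eq_zero, ← Pi.sub_apply, hc, hc0, mul_zero]

theorem isJostPlus_jostPlus (hV : ∀ n, (V n).IsHermitian) (hmom : FiniteFirstMoment V)
    (hz0 : z ≠ 0) (hz : ‖z‖ ≤ 1) : IsJostPlus V z (jostPlus V z) :=
  Classical.epsilon_spec (existsUnique_isJostPlus hV hmom hz0 hz).exists

theorem existsUnique_isJostMinus (hV : ∀ n, (V n).IsHermitian) (hmom : FiniteFirstMoment V)
    (hz0 : z ≠ 0) (hz : ‖z‖ ≤ 1) : ∃! u, IsJostMinus V z⁻¹ u := by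
  obtain ⟨u, hu, huniq⟩ := existsUnique_isJostPlus (isHermitian_reflect hV) hmom.reflect hz0 hz
  refine ⟨reflect u, by simpa using hu.reflect, fun w hw => ?_⟩
  rw [← huniq _ hw.reflect, reflect_reflect]

theorem isJostMinus_jostMinus (hV : ∀ n, (V n).IsHermitian) (hmom : FiniteFirstMoment V)
    (hz0 : z ≠ 0) (hz : ‖z‖ ≤ 1) : IsJostMinus V z⁻¹ (jostMinus V z⁻¹) :=
  Classical.epsilon_spec (existsUnique_isJostMinus hV hmom hz0 hz).exists

theorem reflect_jostMinus (hV : ∀ n, (V n).IsHermitian) (hmom : FiniteFirstMoment V)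
    (hz0 : z ≠ 0) (hz : ‖z‖ ≤ 1) : reflect (jostMinus V z⁻¹) = jostPlus (reflect V) z :=
  (existsUnique_isJostPlus (isHermitian_reflect hV) hmom.reflect hz0 hz).unique
    (isJostMinus_jostMinus hV hmom hz0 hz).reflect
    (isJostPlus_jostPlus (isHermitian_reflect hV) hmom.reflect hz0 hz)

theorem jostMinus_eq (hV : ∀ n, (V n).IsHermitian) (hmom : FiniteFirstMoment V)
    (hz0 : z ≠ 0) (hz : ‖z‖ ≤ 1) : jostMinus V z⁻¹ = reflect (jostPlus (reflect V) z) := by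
  rw [← reflect_jostMinus hV hmom hz0 hz, reflect_reflect]

end JostExistence

/-! ### Jost solutions near the band edge -/

/-- The filter of approach to `1` within the closed unit disk. -/
noncomputable abbrev edgeFilter : Filter ℂ := 𝓝[Metric.closedBall (0 : ℂ) 1 \ {1}] (1 : ℂ)

theorem edgeFilter_le_nhds : edgeFilter ≤ 𝓝 1 := nhdsWithin_le_nhds

theorem eventually_edgeFilter : ∀ᶠ z in edgeFilter, z ≠ 0 ∧ z ≠ 1 ∧ z ≠ -1 ∧ ‖z‖ ≤ 1 := by
  have h1 : ∀ᶠ z in edgeFilter, z ≠ 0 := edgeFilter_le_nhds (eventually_ne_nhds one_ne_zero)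
  have h2 : ∀ᶠ z in edgeFilter, z ≠ -1 :=
    edgeFilter_le_nhds (eventually_ne_nhds (by norm_num))
  have h3 : ∀ᶠ z in edgeFilter, z ∈ Metric.closedBall (0 : ℂ) 1 \ {1} := self_mem_nhdsWithin
  filter_upwards [h1, h2, h3] with z h1 h2 h3
  exact ⟨h1, h3.2, h2, mem_closedBall_zero_iff.1 h3.1⟩

theorem tendsto_edgeFilter_nhds : Tendsto (fun z : ℂ => z) edgeFilter (𝓝 1) :=
  edgeFilter_le_nhds

theorem tendsto_star_edgeFilter : Tendsto (star : ℂ → ℂ) edgeFilter edgeFilter := by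
  refine tendsto_nhdsWithin_of_tendsto_nhds_of_eventually_within _ ?_ ?_
  · simpa only [star_one] using tendsto_edgeFilter_nhds.star
  · filter_upwards [eventually_edgeFilter] with z hz
    refine ⟨mem_closedBall_zero_iff.2 (by rw [norm_star]; exact hz.2.2.2), fun h => hz.2.1 ?_⟩
    rw [← star_star z, Set.mem_singleton_iff.1 h, star_one]

instance edgeFilter_neBot : edgeFilter.NeBot := by
  have h : Tendsto (fun n : ℕ => (1 : ℂ) - 1 / ((n : ℂ) + 1)) atTop (𝓝 1) := by
    simpa using (tendsto_const_nhds (x := (1 : ℂ))).sub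
      (tendsto_one_div_add_atTop_nhds_zero_nat (𝕜 := ℂ))
  refine NeBot.mono (f := map (fun n : ℕ => (1 : ℂ) - 1 / ((n : ℂ) + 1)) atTop) inferInstance
    (tendsto_nhdsWithin_of_tendsto_nhds_of_eventually_within _ h (Eventually.of_forall fun n => ?_))
  have hn : (0 : ℝ) < n + 1 := by positivity
  have e : (1 : ℂ) - 1 / ((n : ℂ) + 1) = ((1 - 1 / ((n : ℝ) + 1) : ℝ) : ℂ) := by push_cast; rfl
  have h1 : 1 / ((n : ℝ) + 1) ≤ 1 := by
    rw [div_le_one hn]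
    linarith [(Nat.cast_nonneg n : (0 : ℝ) ≤ n)]
  have h2 : 0 < 1 / ((n : ℝ) + 1) := by positivity
  refine ⟨mem_closedBall_zero_iff.2 ?_, fun h => ?_⟩
  · rw [e, Complex.norm_real, Real.norm_eq_abs, abs_le]
    constructor <;> linarith
  · rw [Set.mem_singleton_iff, e, ← Complex.ofReal_one, Complex.ofReal_inj] at h
    linarith

/-- An Abel-type limit: if `F z n` is the average of `F z (n + 1)` and `g z n` with weights `z` and
`1 - z`, and the increments of `g z` are summable uniformly in `z`, then `F z 0` converges to
`lim g 1` as `z → 1`, tangential approach to the unit circle included. -/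
theorem tendsto_edge_of_average {E : Type*} [NormedAddCommGroup E] [NormedSpace ℂ E]
    [CompleteSpace E] {F g : ℂ → ℕ → E} {γ : ℕ → ℝ} {a : E} (hγ : Summable γ)
    (hg : ∀ z, ‖z‖ ≤ 1 → ∀ n, ‖g z (n + 1) - g z n‖ ≤ γ n)
    (hF : ∀ᶠ z in edgeFilter, (∀ n, F z n = z • F z (n + 1) + (1 - z) • g z n) ∧
      Tendsto (fun n => F z n - g z n) atTop (𝓝 0))
    (hg1 : ∀ n, Tendsto (fun z => g z n) edgeFilter (𝓝 (g 1 n)))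
    (ha : Tendsto (g 1) atTop (𝓝 a)) : Tendsto (fun z => F z 0) edgeFilter (𝓝 a) := by
  have hle : ∀ z, ‖z‖ ≤ 1 → ∀ n, ‖z ^ (n + 1) • (g z (n + 1) - g z n)‖ ≤ γ n := fun z hz n => by
    rw [norm_smul, norm_pow]
    exact (mul_le_of_le_one_left (norm_nonneg _) (pow_le_one₀ (norm_nonneg _) hz)).trans (hg z hz n)
  have hsum : ∀ z, ‖z‖ ≤ 1 → Summable fun n => z ^ (n + 1) • (g z (n + 1) - g z n) := fun z hz =>
    Summable.of_norm_bounded hγ (hle z hz)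
  have h1 : ∑' n, (1 : ℂ) ^ (n + 1) • (g 1 (n + 1) - g 1 n) = a - g 1 0 := by
    refine tendsto_nhds_unique (hsum 1 (by simp)).hasSum.tendsto_sum_nat ?_
    refine (ha.sub_const (g 1 0)).congr fun n => ?_
    simp only [one_pow, one_smul]
    exact (Finset.sum_range_sub _ n).symm
  have hlim : Tendsto (fun z => ∑' n, z ^ (n + 1) • (g z (n + 1) - g z n)) edgeFilter
      (𝓝 (∑' n, (1 : ℂ) ^ (n + 1) • (g 1 (n + 1) - g 1 n))) := by
    refine tendsto_tsum_of_dominated_convergence hγ (fun n => ?_) ?_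
    · exact (tendsto_edgeFilter_nhds.pow _).smul ((hg1 _).sub (hg1 _))
    · filter_upwards [eventually_edgeFilter] with z hz n using hle z hz.2.2.2 n
  rw [h1] at hlim
  have hfin := hlim.add (hg1 0)
  rw [sub_add_cancel] at hfin
  refine hfin.congr' ?_
  filter_upwards [eventually_edgeFilter, hF] with z hz ⟨hz1, hz2⟩
  have hpart : ∀ k, ∑ n ∈ Finset.range k, z ^ (n + 1) • (g z (n + 1) - g z n)
      = (F z 0 - g z 0) - z ^ k • (F z k - g z k) := by
    intro k
    induction k with
    | zero => simp
    | succ k ih =>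
      rw [Finset.sum_range_succ, ih, hz1 k]
      module
  have h2 : Tendsto (fun k => z ^ k • (F z k - g z k)) atTop (𝓝 0) := by
    refine squeeze_zero_norm (fun k => ?_) (tendsto_zero_iff_norm_tendsto_zero.1 hz2)
    rw [norm_smul, norm_pow]
    exact mul_le_of_le_one_left (norm_nonneg _) (pow_le_one₀ (norm_nonneg _) hz.2.2.2)
  have h3 := (tendsto_const_nhds (x := F z 0 - g z 0)).sub h2
  rw [sub_zero] at h3
  rw [tendsto_nhds_unique (hsum z hz.2.2.2).hasSum.tendsto_sum_nat
    (h3.congr fun k => (hpart k).symm), sub_add_cancel]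

/-- The Wronskian of solutions at different energies changes from site to site by the energy
difference. -/
theorem wronskianAt_sub_wronskianAt {L : ℕ} {V : ℤ → Mat L} (hV : ∀ n, (V n).IsHermitian) {w z : ℂ}
    {u v : ℤ → Mat L} (hu : IsSolution V w u) (hv : IsSolution V z v) (n : ℤ) :
    wronskianAt u v n - wronskianAt u v (n - 1)
      = (Complex.I * (star (w + w⁻¹) - (z + z⁻¹))) • ((u n)ᴴ * v n) := by
  have e1 : (u (n + 1))ᴴ = star (w + w⁻¹) • (u n)ᴴ - (u n)ᴴ * V n - (u (n - 1))ᴴ := by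
    rw [hu.apply_add_one, Matrix.conjTranspose_sub, Matrix.conjTranspose_sub,
      Matrix.conjTranspose_smul, Matrix.conjTranspose_mul, (hV n).eq]
  simp only [wronskianAt, sub_add_cancel, e1, hv.apply_add_one, sub_mul, mul_sub, Matrix.smul_mul,
    Matrix.mul_smul, Matrix.mul_assoc]
  module

section BandEdge

open scoped Matrix.Norms.L2Operator

variable {L : ℕ} {V : ℤ → Mat L}

/-- The representation of `exists_isJostPlus`, for the solution `jostPlus V z`. -/
theorem jostPlus_expansion (hV : ∀ n, (V n).IsHermitian) (hmom : FiniteFirstMoment V) :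
    ∃ (N : ℕ) (h : ℕ → ℂ → Mat L) (β : ℕ → ℝ) (C : ℝ), Summable β ∧
      Tendsto (fun n : ℕ => (n : ℝ) * β n) atTop (𝓝 0) ∧
      (∀ n, ContinuousOn (h n) (Metric.closedBall 0 1)) ∧
      (∀ n z, ‖z‖ ≤ 1 → ‖h n z‖ ≤ C) ∧
      (∀ n z, ‖z‖ ≤ 1 → ‖h (n + 1) z - h n z‖ ≤ β n) ∧
      (∀ z, ‖z‖ ≤ 1 → Tendsto (fun n => h n z) atTop (𝓝 1)) ∧
      ∀ z, z ≠ 0 → ‖z‖ ≤ 1 → ∀ n : ℕ, jostPlus V z (N + n) = z ^ ((N : ℤ) + n) • h n z := by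
  obtain ⟨N, h, β, C, h1, h2, h3, h4, h5, h6, h7⟩ := exists_isJostPlus hmom
  refine ⟨N, h, β, C, h1, h2, h3, h4, h5, h6, fun z hz0 hz n => ?_⟩
  obtain ⟨u, hu, hun⟩ := h7 z hz0 hz
  rw [← hun, (existsUnique_isJostPlus hV hmom hz0 hz).unique
    (isJostPlus_jostPlus hV hmom hz0 hz) hu]

theorem tendsto_add_inv_edge : Tendsto (fun z : ℂ => z + z⁻¹) edgeFilter (𝓝 (1 + 1⁻¹)) :=
  tendsto_edgeFilter_nhds.add (tendsto_edgeFilter_nhds.inv₀ one_ne_zero)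

theorem tendsto_jostPlus_edge (hV : ∀ n, (V n).IsHermitian) (hmom : FiniteFirstMoment V) (n : ℤ) :
    Tendsto (fun z => jostPlus V z n) edgeFilter (𝓝 (jostPlus V 1 n)) := by
  obtain ⟨N, h, -, -, -, -, hc, -, -, -, hh⟩ := jostPlus_expansion hV hmom
  have hnat : ∀ k : ℕ, Tendsto (fun z => jostPlus V z (N + k)) edgeFilter
      (𝓝 (jostPlus V 1 (N + k))) := by
    intro k
    rw [hh 1 one_ne_zero (by simp)]
    have h1 : Tendsto (h k) edgeFilter (𝓝 (h k 1)) :=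
      (hc k 1 (by simp)).mono_left (nhdsWithin_mono _ Set.sdiff_subset)
    refine ((tendsto_edgeFilter_nhds.zpow₀ _ (Or.inl one_ne_zero)).smul h1).congr' ?_
    filter_upwards [eventually_edgeFilter] with z hz
    rw [hh z hz.1 hz.2.2.2]
  have hsol : ∀ᶠ z in edgeFilter, IsSolution V z (jostPlus V z) := by
    filter_upwards [eventually_edgeFilter] with z hz
    exact (isJostPlus_jostPlus hV hmom hz.1 hz.2.2.2).1
  have hsol1 := (isJostPlus_jostPlus hV hmom (z := 1) one_ne_zero (by simp)).1
  have hneg : ∀ k : ℕ,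
      Tendsto (fun z => jostPlus V z (N - k)) edgeFilter (𝓝 (jostPlus V 1 (N - k))) ∧
      Tendsto (fun z => jostPlus V z (N - k + 1)) edgeFilter (𝓝 (jostPlus V 1 (N - k + 1))) := by
    intro k
    induction k with
    | zero => exact ⟨by simpa using hnat 0, by simpa using hnat 1⟩
    | succ k ih =>
      rw [show (N : ℤ) - (k + 1 : ℕ) + 1 = N - k by push_cast; ring,
        show (N : ℤ) - (k + 1 : ℕ) = N - k - 1 by push_cast; ring]
      refine ⟨?_, ih.1⟩
      rw [hsol1.apply_sub_one]
      refine (((tendsto_add_inv_edge.smul ih.1).sub (ih.1.const_mul _)).sub ih.2).congr' ?_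
      filter_upwards [hsol] with z hz
      rw [hz.apply_sub_one]
  rcases le_total (N : ℤ) n with hn | hn
  · obtain ⟨k, rfl⟩ := Int.le.dest hn
    exact hnat k
  · obtain ⟨k, hk⟩ := Int.le.dest hn
    rw [show n = N - k by omega]
    exact (hneg k).1

/-- At the band edge the increments of the Jost solution are `o(1/n)`. -/
theorem tendsto_mul_increment_jostPlus (hV : ∀ n, (V n).IsHermitian) (hmom : FiniteFirstMoment V) :
    Tendsto (fun n : ℤ => (n : ℂ) • (jostPlus V 1 (n + 1) - jostPlus V 1 n)) atTop (𝓝 0) := by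
  obtain ⟨N, h, β, -, hβ, hβ', -, -, hle, -, hh⟩ := jostPlus_expansion hV hmom
  refine tendsto_atTop_int_of_nat N (squeeze_zero_norm (a := fun n : ℕ => N * β n + n * β n)
    (fun n => ?_) ?_)
  · have e1 := hh 1 one_ne_zero (by simp) n
    have e2 := hh 1 one_ne_zero (by simp) (n + 1)
    rw [one_zpow, one_smul] at e1 e2
    rw [e1, add_assoc, show (n : ℤ) + 1 = (n + 1 : ℕ) by push_cast; ring, e2, norm_smul, ← add_mul,
      Complex.norm_intCast]
    have : |(((N : ℤ) + n : ℤ) : ℝ)| = N + n := by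
      push_cast
      exact abs_of_nonneg (by positivity)
    rw [this]
    exact mul_le_mul_of_nonneg_left (hle n 1 (by simp)) (by positivity)
  · simpa using (hβ.tendsto_atTop_zero.const_mul (N : ℝ)).add hβ'

/-- First-order behaviour at the band edge, where `u_+^z` itself need not be differentiable:
`W(u_+^1, u_+^z) = i (1 - z) (1 + o(1))`. -/
theorem tendsto_wronskianAt_jostPlus_edge (hV : ∀ n, (V n).IsHermitian)
    (hmom : FiniteFirstMoment V) (m : ℤ) :
    Tendsto (fun z => (Complex.I * (1 - z))⁻¹ • wronskianAt (jostPlus V 1) (jostPlus V z) m)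
      edgeFilter (𝓝 1) := by
  obtain ⟨N, h, β, C, hβ, -, hc, hC, hle, hlim, hh⟩ := jostPlus_expansion hV hmom
  have hsol : ∀ᶠ z in edgeFilter, IsSolution V z (jostPlus V z) := by
    filter_upwards [eventually_edgeFilter] with z hz
    exact (isJostPlus_jostPlus hV hmom hz.1 hz.2.2.2).1
  have hsol1 := (isJostPlus_jostPlus hV hmom (z := 1) one_ne_zero (by simp)).1
  have h11 : ‖(1 : ℂ)‖ ≤ 1 := by simp
  have hstep : ∀ᶠ z in edgeFilter, ∀ n,
      (Complex.I * (1 - z))⁻¹ • wronskianAt (jostPlus V 1) (jostPlus V z) n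
        - (Complex.I * (1 - z))⁻¹ • wronskianAt (jostPlus V 1) (jostPlus V z) (n - 1)
      = (z⁻¹ * (z - 1)) • ((jostPlus V 1 n)ᴴ * jostPlus V z n) := by
    filter_upwards [eventually_edgeFilter, hsol] with z hz hs n
    rw [← smul_sub, wronskianAt_sub_wronskianAt hV hsol1 hs, smul_smul]
    congr 1
    have h1z : (1 : ℂ) - z ≠ 0 := sub_ne_zero.2 hz.2.1.symm
    have hz0 := hz.1
    have hI := Complex.I_ne_zero
    simp only [inv_one, star_add, star_one]
    field_simp
    ring
  have hN : Tendsto (fun z => (Complex.I * (1 - z))⁻¹ •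
      wronskianAt (jostPlus V 1) (jostPlus V z) N) edgeFilter (𝓝 1) := by
    -- With `h n z = z^(-n) u_+^z(n)` and `g = (u_+^1)^* h`, the energy difference `-(1 - z)² / z`
    -- in the Wronskian identity turns into the averaging recurrence for `F`.
    let g : ℂ → ℕ → Mat L := fun z n => (h (n + 1) 1)ᴴ * h (n + 1) z
    let F : ℂ → ℕ → Mat L := fun z n => (Complex.I * (1 - z))⁻¹ • ((z ^ ((N : ℤ) + n))⁻¹ •
      wronskianAt (jostPlus V 1) (jostPlus V z) (N + n))
    have hH : ∀ A : Mat L, ‖Aᴴ‖ = ‖A‖ := Matrix.l2_opNorm_conjTranspose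
    have hgt : ∀ z, ‖z‖ ≤ 1 → Tendsto (g z) atTop (𝓝 1) := fun z hz => by
      have h1 := (hlim 1 h11).star
      rw [star_one] at h1
      have h2 := (h1.mul (hlim z hz)).comp (tendsto_add_atTop_nat 1)
      rw [mul_one] at h2
      exact h2
    have hFform : ∀ z, z ≠ 0 → z ≠ 1 → ‖z‖ ≤ 1 → ∀ n,
        F z n = (1 - z)⁻¹ • ((h (n + 1) 1)ᴴ * h n z - z • ((h n 1)ᴴ * h (n + 1) z)) := by
      intro z hz0 hz1 hz n
      have e : (N : ℤ) + n + 1 = N + (n + 1 : ℕ) := by push_cast; ring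
      simp only [F, wronskianAt]
      rw [e, hh 1 one_ne_zero h11, hh 1 one_ne_zero h11, hh z hz0 hz, hh z hz0 hz, one_zpow,
        one_zpow, one_smul, one_smul, ← e, zpow_add_one₀ hz0, Matrix.mul_smul, Matrix.mul_smul,
        mul_smul, ← smul_sub, smul_smul, smul_smul, smul_smul]
      congr 1
      have h1z : (1 : ℂ) - z ≠ 0 := sub_ne_zero.2 hz1.symm
      have := zpow_ne_zero ((N : ℤ) + n) hz0
      have hI := Complex.I_ne_zero
      field_simp
    have hF0 : Tendsto (fun z => F z 0) edgeFilter (𝓝 1) := by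
      refine tendsto_edge_of_average (g := g) (γ := fun n => 2 * C * β (n + 1))
        (((summable_nat_add_iff 1).2 hβ).mul_left _) ?_ ?_ ?_ (hgt 1 h11)
      · intro z hz n
        have e : g z (n + 1) - g z n = (h (n + 2) 1)ᴴ * (h (n + 2) z - h (n + 1) z)
            + (h (n + 2) 1 - h (n + 1) 1)ᴴ * h (n + 1) z := by
          simp only [g, Matrix.conjTranspose_sub, mul_sub, sub_mul]
          abel
        rw [e]
        refine (norm_add_le_of_le (norm_mul_le _ _) (norm_mul_le _ _)).trans ?_
        rw [hH, hH]
        have a1 := hC (n + 2) 1 h11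
        have a2 := hle (n + 1) z hz
        have a3 := hle (n + 1) 1 h11
        have a4 := hC (n + 1) z hz
        have b1 := mul_le_mul a1 a2 (norm_nonneg _) ((norm_nonneg _).trans a1)
        have b2 := mul_le_mul a3 a4 (norm_nonneg _) ((norm_nonneg _).trans a3)
        linarith
      · filter_upwards [eventually_edgeFilter, hstep] with z hz hs
        refine ⟨fun n => ?_, ?_⟩
        · have hs' := hs (N + n + 1)
          have e : (N : ℤ) + n + 1 = N + (n + 1 : ℕ) := by push_cast; ring
          rw [add_sub_cancel_right] at hs'
          have eg : (jostPlus V 1 (N + n + 1))ᴴ * jostPlus V z (N + n + 1)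
              = z ^ ((N : ℤ) + n + 1) • g z n := by
            rw [e, hh 1 one_ne_zero h11, hh z hz.1 hz.2.2.2, one_zpow, one_smul, Matrix.mul_smul]
          rw [eg] at hs'
          simp only [F]
          rw [← e, smul_comm _ ((z ^ ((N : ℤ) + n))⁻¹), smul_comm _ ((z ^ ((N : ℤ) + n + 1))⁻¹)]
          rw [← sub_eq_iff_eq_add.2 (sub_eq_iff_eq_add'.1 hs'), zpow_add_one₀ hz.1]
          have hx := zpow_ne_zero ((N : ℤ) + n) hz.1
          have hz0 := hz.1
          match_scalars <;> field_simp
          ring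
        · have hform := hFform z hz.1 hz.2.1 hz.2.2.2
          have hl1 := (hlim 1 h11)
          have hl1s := hl1.star
          rw [star_one] at hl1s
          have hl := hlim z hz.2.2.2
          have t1 := tendsto_add_atTop_nat 1
          have hh' := ((((hl1s.comp t1).mul hl).sub
            ((hl1s.mul (hl.comp t1)).const_smul z)).const_smul (1 - z)⁻¹).sub (hgt z hz.2.2.2)
          have h1z : (1 : ℂ) - z ≠ 0 := sub_ne_zero.2 hz.2.1.symm
          have e0 : (1 - z)⁻¹ • ((1 : Mat L) * 1 - z • (1 * 1)) - 1 = 0 := by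
            rw [mul_one, show (1 : Mat L) - z • 1 = (1 - z) • 1 by rw [sub_smul, one_smul],
              smul_smul, inv_mul_cancel₀ h1z, one_smul, sub_self]
          rw [e0] at hh'
          exact hh'.congr fun n => by rw [hform n]; rfl
      · intro n
        exact tendsto_const_nhds.mul
          ((hc (n + 1) 1 (by simp)).mono_left (nhdsWithin_mono _ Set.sdiff_subset))
    have hzN : Tendsto (fun z : ℂ => z ^ (N : ℤ)) edgeFilter (𝓝 1) := by
      simpa using tendsto_edgeFilter_nhds.zpow₀ (N : ℤ) (Or.inl one_ne_zero)
    have := hzN.smul hF0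
    rw [one_smul] at this
    refine this.congr' ?_
    filter_upwards [eventually_edgeFilter] with z hz
    simp only [F, Nat.cast_zero, add_zero]
    rw [smul_comm _ ((z ^ (N : ℤ))⁻¹), smul_smul, mul_inv_cancel₀ (zpow_ne_zero _ hz.1), one_smul]
  have hdiff : ∀ n, Tendsto (fun z => (z⁻¹ * (z - 1)) • ((jostPlus V 1 n)ᴴ * jostPlus V z n))
      edgeFilter (𝓝 0) := by
    intro n
    have h1 : Tendsto (fun z : ℂ => z⁻¹ * (z - 1)) edgeFilter (𝓝 0) := by
      simpa using (tendsto_edgeFilter_nhds.inv₀ one_ne_zero).mul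
        (tendsto_edgeFilter_nhds.sub_const 1)
    simpa using h1.smul ((tendsto_jostPlus_edge hV hmom n).const_mul (jostPlus V 1 n)ᴴ)
  induction m using Int.inductionOn' (b := (N : ℤ)) with
  | zero => exact hN
  | succ k _ ih =>
    have := ih.add (hdiff (k + 1))
    rw [add_zero] at this
    refine this.congr' ?_
    filter_upwards [hstep] with z hz
    rw [← hz (k + 1), add_sub_cancel_right, add_sub_cancel]
  | pred k _ ih =>
    have := ih.sub (hdiff k)
    rw [sub_zero] at this
    refine this.congr' ?_
    filter_upwards [hstep] with z hz
    rw [← hz k, sub_sub_cancel]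

theorem jostMinus_one_eq (hV : ∀ n, (V n).IsHermitian) (hmom : FiniteFirstMoment V) :
    jostMinus V 1 = reflect (jostPlus (reflect V) 1) := by
  simpa using jostMinus_eq hV hmom (z := 1) one_ne_zero (by simp)

theorem tendsto_jostMinus_edge (hV : ∀ n, (V n).IsHermitian) (hmom : FiniteFirstMoment V) (n : ℤ) :
    Tendsto (fun z => jostMinus V z⁻¹ n) edgeFilter (𝓝 (jostMinus V 1 n)) := by
  rw [jostMinus_one_eq hV hmom]
  refine (tendsto_jostPlus_edge (isHermitian_reflect hV) hmom.reflect (-n)).congr' ?_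
  filter_upwards [eventually_edgeFilter] with z hz
  rw [jostMinus_eq hV hmom hz.1 hz.2.2.2, reflect_apply]

theorem tendsto_wronskianAt_jostMinus_edge (hV : ∀ n, (V n).IsHermitian)
    (hmom : FiniteFirstMoment V) (m : ℤ) :
    Tendsto (fun z => (Complex.I * (1 - z))⁻¹ • wronskianAt (jostMinus V 1) (jostMinus V z⁻¹) m)
      edgeFilter (𝓝 (-1)) := by
  refine (tendsto_wronskianAt_jostPlus_edge (isHermitian_reflect hV) hmom.reflect
    (-m - 1)).neg.congr' ?_
  filter_upwards [eventually_edgeFilter] with z hz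
  rw [jostMinus_one_eq hV hmom, jostMinus_eq hV hmom hz.1 hz.2.2.2, wronskianAt_reflect, smul_neg]

end BandEdge

variable {L : ℕ} {V : ℤ → Mat L}

/-! ### Connection coefficients on the unit circle -/

section Circle

open scoped Matrix.Norms.L2Operator

variable {z : ℂ}

theorem IsJostMinus.eventually_isUnit {u : ℤ → Mat L} (hz0 : z ≠ 0) (hu : IsJostMinus V z⁻¹ u) :
    ∀ᶠ n : ℤ in atBot, IsUnit (u n) :=
  (tendsto_neg_atBot_atTop.eventually (hu.reflect.eventually_isUnit hz0)).mono fun n hn => by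
    simpa using hn

theorem wronskianAt_jostPlus_star (hV : ∀ n, (V n).IsHermitian) (hmom : FiniteFirstMoment V)
    (hz0 : z ≠ 0) (hz : ‖z‖ ≤ 1) (n : ℤ) :
    wronskianAt (jostPlus V (star z)) (jostPlus V z) n = 0 :=
  wronskianAt_eq_zero_of_tendsto hV hz0 hz
    (isJostPlus_jostPlus hV hmom (star_ne_zero.2 hz0) (by rwa [norm_star]))
    (isJostPlus_jostPlus hV hmom hz0 hz).1 (isJostPlus_jostPlus hV hmom hz0 hz).2 n

theorem wronskianAt_jostMinus_star (hV : ∀ n, (V n).IsHermitian) (hmom : FiniteFirstMoment V)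
    (hz0 : z ≠ 0) (hz : ‖z‖ ≤ 1) (n : ℤ) :
    wronskianAt (jostMinus V (star z)⁻¹) (jostMinus V z⁻¹) n = 0 := by
  rw [jostMinus_eq hV hmom hz0 hz,
    jostMinus_eq hV hmom (star_ne_zero.2 hz0) (by rwa [norm_star]), wronskianAt_reflect,
    wronskianAt_jostPlus_star (isHermitian_reflect hV) hmom.reflect hz0 hz, neg_zero]

theorem star_eq_inv_of_norm_eq_one (hz : ‖z‖ = 1) : star z = z⁻¹ :=
  (Complex.inv_eq_conj hz).symm

theorem nu_inv (z : ℂ) : (nu z)⁻¹ = Complex.I * (z⁻¹ - z) := by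
  rw [nu, inv_div, div_eq_mul_inv, Complex.inv_I]
  ring

theorem nu_ne_zero (hz0 : z ≠ 0) (h1 : z ≠ 1) (h2 : z ≠ -1) : nu z ≠ 0 := by
  refine div_ne_zero Complex.I_ne_zero (sub_ne_zero.2 fun h => ?_)
  have : z * z = 1 := by nth_rw 2 [h]; exact mul_inv_cancel₀ hz0
  rcases mul_self_eq_one_iff.1 this with h | h
  exacts [h1 h, h2 h]

theorem nu_inv_arg (z : ℂ) : nu z⁻¹ = -nu z := by
  rw [nu, nu, inv_inv, ← neg_sub z, div_neg]

/-- The Wronskian of a Jost solution with itself on the unit circle. -/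
theorem wronskianAt_jostPlus_self (hV : ∀ n, (V n).IsHermitian) (hmom : FiniteFirstMoment V)
    (hz : ‖z‖ = 1) (n : ℤ) :
    wronskianAt (jostPlus V z) (jostPlus V z) n = (nu z)⁻¹ • (1 : Mat L) := by
  have hz0 : z ≠ 0 := norm_ne_zero_iff.1 (by rw [hz]; norm_num)
  have hu := isJostPlus_jostPlus hV hmom hz0 hz.le
  set u := jostPlus V z
  set f : ℤ → Mat L := fun n => (z ^ n)⁻¹ • u n
  have hs := star_eq_inv_of_norm_eq_one hz
  have hus : IsSolution V (star z) u := by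
    rw [hs]
    exact hu.1.inv
  have ht : Tendsto (fun n : ℤ => n + 1) atTop atTop := tendsto_atTop_add_const_right _ _ tendsto_id
  have hf : Tendsto f atTop (𝓝 1) := hu.2
  have hfs : Tendsto (fun n => (f n)ᴴ) atTop (𝓝 1) := by
    simpa only [Matrix.star_eq_conjTranspose, Matrix.conjTranspose_one] using hf.star
  have hform : ∀ n, Complex.I • (z⁻¹ • ((f (n + 1))ᴴ * f n) - z • ((f n)ᴴ * f (n + 1)))
      = wronskianAt u u n := by
    intro n
    have e : ∀ n, (f n)ᴴ = z ^ n • (u n)ᴴ := fun n => by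
      simp only [f, Matrix.conjTranspose_smul, star_inv₀, star_zpow₀, hs, inv_zpow, inv_inv]
    rw [e, e]
    simp only [wronskianAt, f, Matrix.smul_mul, Matrix.mul_smul, smul_smul, zpow_add_one₀ hz0]
    have := zpow_ne_zero n hz0
    congr 2
    · rw [← one_smul ℂ ((u (n + 1))ᴴ * u n), smul_smul]
      congr 1
      field_simp
    · rw [← one_smul ℂ ((u n)ᴴ * u (n + 1)), smul_smul]
      congr 1
      field_simp
  have hlim := ((((hfs.comp ht).mul hf).const_smul z⁻¹).sub
    ((hfs.mul (hf.comp ht)).const_smul z)).const_smul Complex.I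
  have hc : Tendsto (fun _ : ℤ => wronskianAt u u n) atTop
      (𝓝 (Complex.I • (z⁻¹ • ((1 : Mat L) * 1) - z • (1 * 1)))) := by
    refine hlim.congr fun k => ?_
    rw [wronskianAt_eq hV hus hu.1 n, ← wronskianAt_eq hV hus hu.1 k]
    exact hform k
  rw [tendsto_nhds_unique tendsto_const_nhds hc, nu_inv, mul_one, ← sub_smul, smul_smul]

theorem wronskianAt_jostMinus_self (hV : ∀ n, (V n).IsHermitian) (hmom : FiniteFirstMoment V)
    (hz : ‖z‖ = 1) (n : ℤ) :
    wronskianAt (jostMinus V z⁻¹) (jostMinus V z⁻¹) n = -(nu z)⁻¹ • (1 : Mat L) := by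
  have hz0 : z ≠ 0 := norm_ne_zero_iff.1 (by rw [hz]; norm_num)
  rw [jostMinus_eq hV hmom hz0 hz.le, wronskianAt_reflect,
    wronskianAt_jostPlus_self (isHermitian_reflect hV) hmom.reflect hz, neg_smul]

/-- Expansion of a solution in a pair of solutions with diagonal Wronskian form. -/
theorem IsSolution.eq_add_iff (hV : ∀ n, (V n).IsHermitian) (hz : ‖z‖ = 1) {ν : ℂ} (hν : ν ≠ 0)
    {a b w : ℤ → Mat L} (ha : IsSolution V z a) (hb : IsSolution V z b) (hw : IsSolution V z w)
    (haa : ∀ n, wronskianAt a a n = ν⁻¹ • 1) (hbb : ∀ n, wronskianAt b b n = -ν⁻¹ • 1)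
    (hba : ∀ n, wronskianAt b a n = 0) (hex : ∃ n, IsUnit (a n) ∧ IsUnit (b n)) (M N : Mat L) :
    (∀ n, w n = a n * M + b n * N) ↔ M = ν • wronskian a w ∧ N = -ν • wronskian b w := by
  have hab : ∀ n, wronskianAt a b n = 0 := fun n => by
    rw [← conjTranspose_wronskianAt, hba, Matrix.conjTranspose_zero]
  have hs := star_eq_inv_of_norm_eq_one hz
  have hWa : ∀ n M N, wronskianAt a ((fun n => a n * M) + fun n => b n * N) n = ν⁻¹ • M := by
    intro n M N
    rw [wronskianAt_add_right, wronskianAt_mul_right, wronskianAt_mul_right, haa, hab,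
      Matrix.smul_mul, one_mul, zero_mul, add_zero]
  have hWb : ∀ n M N, wronskianAt b ((fun n => a n * M) + fun n => b n * N) n = -ν⁻¹ • N := by
    intro n M N
    rw [wronskianAt_add_right, wronskianAt_mul_right, wronskianAt_mul_right, hbb, hba,
      Matrix.smul_mul, one_mul, zero_mul, zero_add]
  constructor
  · intro h
    have h' : w = (fun n => a n * M) + fun n => b n * N := funext h
    rw [wronskian, wronskian, h', hWa, hWb, smul_smul, smul_smul, neg_mul_neg,
      mul_inv_cancel₀ hν, one_smul, one_smul]
    exact ⟨rfl, rfl⟩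
  · rintro ⟨hM, hN⟩
    obtain ⟨n, han, hbn⟩ := hex
    set c : ℤ → Mat L := w - ((fun n => a n * M) + fun n => b n * N)
    have hc : IsSolution V z c := hw.sub ((ha.mul_right M).add (hb.mul_right N))
    have has : IsSolution V (star z) a := by rw [hs]; exact ha.inv
    have hbs : IsSolution V (star z) b := by rw [hs]; exact hb.inv
    have hca : wronskianAt a c n = 0 := by
      rw [wronskianAt_sub_right, hWa, hM, wronskianAt_eq hV has hw, smul_smul, inv_mul_cancel₀ hν,
        one_smul, wronskian, sub_self]
    have hcb : wronskianAt b c n = 0 := by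
      rw [wronskianAt_sub_right, hWb, hN, wronskianAt_eq hV hbs hw, smul_smul, neg_mul_neg,
        inv_mul_cancel₀ hν, one_smul, wronskian, sub_self]
    have hmul := ha.eq_mul_of_wronskianAt_eq_zero hc hbn han (hba n) hcb
    have h0 : (a n)⁻¹ * c n = 0 := by
      rw [funext hmul, wronskianAt_mul_right, haa, Matrix.smul_mul, one_mul,
        smul_eq_zero_iff_right (inv_ne_zero hν)] at hca
      exact hca
    intro k
    have := hmul k
    rw [h0, mul_zero] at this
    exact sub_eq_zero.1 this

/-- `M_±` and `N_±` are the connection coefficients of the Jost solutions on the circle. -/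
theorem connection_coefficients (hV : ∀ n, (V n).IsHermitian) (hmom : FiniteFirstMoment V)
    (hz : ‖z‖ = 1) (h1 : z ≠ 1) (h2 : z ≠ -1) (M N : Mat L) :
    ((∀ n, jostPlus V z n = jostMinus V z n * M + jostMinus V z⁻¹ n * N) ↔
        M = MPlus V z ∧ N = NPlus V z) ∧
      ((∀ n, jostMinus V z⁻¹ n = jostPlus V z n * N + jostPlus V z⁻¹ n * M) ↔
        M = MMinus V z ∧ N = NMinus V z) := by
  have hz0 : z ≠ 0 := norm_ne_zero_iff.1 (by rw [hz]; norm_num)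
  have hi0 : z⁻¹ ≠ 0 := inv_ne_zero hz0
  have hi : ‖z⁻¹‖ = 1 := by rw [norm_inv, hz, inv_one]
  have hs := star_eq_inv_of_norm_eq_one hz
  have hsi := star_eq_inv_of_norm_eq_one hi
  have hν := nu_ne_zero hz0 h1 h2
  have jp := isJostPlus_jostPlus hV hmom hz0 hz.le
  have jpi := isJostPlus_jostPlus hV hmom hi0 hi.le
  have jm := isJostMinus_jostMinus hV hmom hz0 hz.le
  have jmi := isJostMinus_jostMinus hV hmom hi0 hi.le
  have jmi_unit := jmi.eventually_isUnit hi0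
  rw [inv_inv] at jmi jmi_unit
  constructor
  · have := IsSolution.eq_add_iff hV hz hν jmi.1 (isSolution_inv_iff.1 jm.1) jp.1 (fun n => ?_)
      (wronskianAt_jostMinus_self hV hmom hz) (fun n => ?_)
      (jmi_unit.and (jm.eventually_isUnit hz0)).exists M N
    · rw [this, MPlus, NPlus, hs, inv_inv]
    · have := wronskianAt_jostMinus_self hV hmom hi n
      rwa [inv_inv, nu_inv_arg, inv_neg, neg_neg] at this
    · have := wronskianAt_jostMinus_star hV hmom hi0 hi.le n
      rwa [hsi, inv_inv z] at this
  · have := IsSolution.eq_add_iff hV hz hν jp.1 (isSolution_inv_iff.1 jpi.1)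
      (isSolution_inv_iff.1 jm.1) (wronskianAt_jostPlus_self hV hmom hz) (fun n => ?_) (fun n => ?_)
      ((jp.eventually_isUnit hz0).and (jpi.eventually_isUnit hi0)).exists N M
    · rw [this, MMinus, NMinus, hs, and_comm]
    · rw [wronskianAt_jostPlus_self hV hmom hi n, nu_inv_arg, inv_neg]
    · have := wronskianAt_jostPlus_star hV hmom hz0 hz.le n
      rwa [hs] at this

end Circle

/-! ### Half-bound states and the map `Γ` -/

section HalfBound

open scoped Matrix.Norms.L2Operator

theorem lin_mul (A B : Mat L) (x : Vec L) : lin (A * B) x = lin A (lin B x) := by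
  simp [Matrix.toLpLin_apply, Matrix.mulVec_mulVec]

theorem lin_one (x : Vec L) : lin (1 : Mat L) x = x := by
  simp

theorem lin_zero (x : Vec L) : lin (0 : Mat L) x = 0 := by
  simp

theorem lin_add (A B : Mat L) (x : Vec L) : lin (A + B) x = lin A x + lin B x := by
  simp

theorem lin_sub (A B : Mat L) (x : Vec L) : lin (A - B) x = lin A x - lin B x := by
  simp

theorem lin_smul (c : ℂ) (A : Mat L) (x : Vec L) : lin (c • A) x = c • lin A x := by
  simp

theorem lin_ext {A B : Mat L} (h : ∀ x, lin A x = lin B x) : A = B :=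
  Matrix.toEuclideanLin.injective (LinearMap.ext h)

theorem inner_lin (A : Mat L) (x y : Vec L) : inner ℂ (lin A x) y = inner ℂ x (lin Aᴴ y) := by
  rw [lin, lin, Matrix.toEuclideanLin_conjTranspose_eq_adjoint, LinearMap.adjoint_inner_right]

theorem norm_lin_le (A : Mat L) (x : Vec L) : ‖lin A x‖ ≤ ‖A‖ * ‖x‖ :=
  Matrix.l2_opNorm_mulVec A x

theorem tendsto_lin {ι : Type*} {l : Filter ι} {A : ι → Mat L} {B : Mat L}
    (h : Tendsto A l (𝓝 B)) (x : Vec L) : Tendsto (fun i => lin (A i) x) l (𝓝 (lin B x)) := by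
  have hc : Continuous fun A : Mat L => lin A x :=
    (LinearMap.applyₗ x ∘ₗ (Matrix.toEuclideanLin :
      Mat L ≃ₗ[ℂ] (Vec L →ₗ[ℂ] Vec L)).toLinearMap).continuous_of_finiteDimensional
  exact (hc.tendsto B).comp h

theorem eq_zero_of_lin_eq_zero {A : Mat L} (hA : IsUnit A) {x : Vec L} (h : lin A x = 0) :
    x = 0 := by
  rw [← lin_one x, ← Matrix.nonsing_inv_mul _ ((Matrix.isUnit_iff_isUnit_det _).1 hA), lin_mul, h,
    map_zero]

/-- The matrix of the orthogonal projection onto `K`. -/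
noncomputable def projMat (K : Submodule ℂ (Vec L)) : Mat L :=
  Matrix.toEuclideanLin.symm (K.starProjection : Vec L →ₗ[ℂ] Vec L)

@[simp] theorem lin_projMat (K : Submodule ℂ (Vec L)) (x : Vec L) :
    lin (projMat K) x = K.starProjection x := by
  simp [projMat]

theorem jostPlus_one_spec (hV : ∀ n, (V n).IsHermitian) (hmom : FiniteFirstMoment V) :
    IsSolution V 1 (jostPlus V 1) ∧ Tendsto (jostPlus V 1) atTop (𝓝 1) := by
  have := isJostPlus_jostPlus hV hmom (z := 1) one_ne_zero (by simp)
  exact ⟨this.1, by simpa using this.2⟩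

theorem jostMinus_one_spec (hV : ∀ n, (V n).IsHermitian) (hmom : FiniteFirstMoment V) :
    IsSolution V 1 (jostMinus V 1) ∧ Tendsto (jostMinus V 1) atBot (𝓝 1) := by
  have := isJostMinus_jostMinus hV hmom (z := 1) one_ne_zero (by simp)
  rw [inv_one] at this
  exact ⟨this.1, by simpa using this.2⟩

theorem wronskianAt_jostPlus_one (hV : ∀ n, (V n).IsHermitian) (hmom : FiniteFirstMoment V)
    (n : ℤ) : wronskianAt (jostPlus V 1) (jostPlus V 1) n = 0 := by
  simpa using wronskianAt_jostPlus_star hV hmom (z := 1) one_ne_zero (by simp) n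

theorem wronskianAt_jostMinus_one (hV : ∀ n, (V n).IsHermitian) (hmom : FiniteFirstMoment V)
    (n : ℤ) : wronskianAt (jostMinus V 1) (jostMinus V 1) n = 0 := by
  simpa using wronskianAt_jostMinus_star hV hmom (z := 1) one_ne_zero (by simp) n

theorem wronskianAt_one_eq (hV : ∀ n, (V n).IsHermitian) {u v : ℤ → Mat L} (hu : IsSolution V 1 u)
    (hv : IsSolution V 1 v) (n : ℤ) : wronskianAt u v n = wronskian u v :=
  wronskianAt_eq hV (by rwa [star_one]) hv n

theorem conjTranspose_wMinusPlus : (wMinusPlus V)ᴴ = wPlusMinus V :=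
  conjTranspose_wronskianAt _ _ _

theorem conjTranspose_wPlusMinus : (wPlusMinus V)ᴴ = wMinusPlus V :=
  conjTranspose_wronskianAt _ _ _

theorem wMinusPlus_mul_projMat : wMinusPlus V * projMat (spaceN V) = 0 := lin_ext fun x => by
  rw [lin_mul, lin_projMat, lin_zero]
  exact (spaceN V).starProjection_apply_mem x

theorem wPlusMinus_mul_projMat : wPlusMinus V * projMat (spaceL V) = 0 := lin_ext fun x => by
  rw [lin_mul, lin_projMat, lin_zero]
  exact (spaceL V).starProjection_apply_mem x

/-- On `𝒩` the Jost solution `u_+^1` is a right multiple of `u_-^1`, by reduction of order. -/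
theorem exists_jostPlus_mul_eq (hV : ∀ n, (V n).IsHermitian) (hmom : FiniteFirstMoment V) :
    ∃ c : Mat L, ∀ n, jostPlus V 1 n * projMat (spaceN V) = jostMinus V 1 n * c := by
  obtain ⟨hp, -⟩ := jostPlus_one_spec hV hmom
  obtain ⟨hm, hmt⟩ := jostMinus_one_spec hV hmom
  obtain ⟨n, hn⟩ := (eventually_isUnit_of_tendsto_one hmt).exists
  refine ⟨_, hm.eq_mul_of_wronskianAt_eq_zero (hp.mul_right _) hn hn
    (wronskianAt_jostMinus_one hV hmom n) ?_⟩
  rw [wronskianAt_mul_right, wronskianAt_one_eq hV hm hp]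
  exact wMinusPlus_mul_projMat

theorem exists_jostMinus_mul_eq (hV : ∀ n, (V n).IsHermitian) (hmom : FiniteFirstMoment V) :
    ∃ c : Mat L, ∀ n, jostMinus V 1 n * projMat (spaceL V) = jostPlus V 1 n * c := by
  obtain ⟨hp, hpt⟩ := jostPlus_one_spec hV hmom
  obtain ⟨hm, -⟩ := jostMinus_one_spec hV hmom
  obtain ⟨n, hn⟩ := (eventually_isUnit_of_tendsto_one hpt).exists
  refine ⟨_, hp.eq_mul_of_wronskianAt_eq_zero (hm.mul_right _) hn hn
    (wronskianAt_jostPlus_one hV hmom n) ?_⟩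
  rw [wronskianAt_mul_right, wronskianAt_one_eq hV hp hm]
  exact wPlusMinus_mul_projMat

theorem mem_spaceL_of_eq (hV : ∀ n, (V n).IsHermitian) (hmom : FiniteFirstMoment V) {ξ χ : Vec L}
    (h : ∀ n, lin (jostPlus V 1 n) ξ = lin (jostMinus V 1 n) χ) : χ ∈ spaceL V := by
  have h0 := congrArg (fun A => lin A ξ) (wronskianAt_jostPlus_one hV hmom 0)
  simp only [wronskianAt, lin_smul, lin_sub, lin_mul, h, map_zero, LinearMap.zero_apply] at h0
  simpa only [spaceL, LinearMap.mem_ker, wPlusMinus, wronskian, wronskianAt, lin_smul, lin_sub,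
    lin_mul] using h0

theorem mem_spaceN_of_eq (hV : ∀ n, (V n).IsHermitian) (hmom : FiniteFirstMoment V) {ξ χ : Vec L}
    (h : ∀ n, lin (jostPlus V 1 n) ξ = lin (jostMinus V 1 n) χ) : ξ ∈ spaceN V := by
  have h0 := congrArg (fun A => lin A χ) (wronskianAt_jostMinus_one hV hmom 0)
  simp only [wronskianAt, lin_smul, lin_sub, lin_mul, ← h, map_zero, LinearMap.zero_apply] at h0
  simpa only [spaceN, LinearMap.mem_ker, wMinusPlus, wronskian, wronskianAt, lin_smul, lin_sub,
    lin_mul] using h0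

/-- The map `Γ`, in the form `u_+^1 ξ = u_-^1 Γ ξ`: it sends the limit at `+∞` of a half-bound
state to its limit at `-∞`. -/
theorem exists_gamma (hV : ∀ n, (V n).IsHermitian) (hmom : FiniteFirstMoment V) :
    ∃ G : spaceN V ≃ₗ[ℂ] spaceL V, ∀ (ξ : spaceN V) (n : ℤ),
      lin (jostPlus V 1 n) (ξ : Vec L) = lin (jostMinus V 1 n) (G ξ : Vec L) := by
  obtain ⟨c, hc⟩ := exists_jostPlus_mul_eq hV hmom
  obtain ⟨c', hc'⟩ := exists_jostMinus_mul_eq hV hmom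
  have h1 : ∀ (ξ : spaceN V) (n : ℤ),
      lin (jostPlus V 1 n) (ξ : Vec L) = lin (jostMinus V 1 n) (lin c (ξ : Vec L)) := by
    intro ξ n
    rw [← lin_mul, ← hc, lin_mul, lin_projMat, Submodule.starProjection_eq_self_iff.2 ξ.2]
  have h2 : ∀ (χ : spaceL V) (n : ℤ),
      lin (jostPlus V 1 n) (lin c' (χ : Vec L)) = lin (jostMinus V 1 n) (χ : Vec L) := by
    intro χ n
    rw [← lin_mul, ← hc', lin_mul, lin_projMat, Submodule.starProjection_eq_self_iff.2 χ.2]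
  obtain ⟨n, hn⟩ := (eventually_isUnit_of_tendsto_one (jostPlus_one_spec hV hmom).2).exists
  obtain ⟨k, hk⟩ := (eventually_isUnit_of_tendsto_one (jostMinus_one_spec hV hmom).2).exists
  let F : spaceN V →ₗ[ℂ] spaceL V :=
    (lin c).restrict fun ξ hξ => mem_spaceL_of_eq hV hmom (h1 ⟨ξ, hξ⟩)
  let F' : spaceL V →ₗ[ℂ] spaceN V :=
    (lin c').restrict fun χ hχ => mem_spaceN_of_eq hV hmom (h2 ⟨χ, hχ⟩)
  have hF : ∀ ξ, (F ξ : Vec L) = lin c ξ := fun _ => rfl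
  have hF' : ∀ χ, (F' χ : Vec L) = lin c' χ := fun _ => rfl
  refine ⟨LinearEquiv.ofLinearMap F F' (LinearMap.ext fun χ => ?_)
    (LinearMap.ext fun ξ => ?_), h1⟩
  · refine Subtype.ext (sub_eq_zero.1 (eq_zero_of_lin_eq_zero hk ?_))
    rw [map_sub, LinearMap.comp_apply, hF, ← h1, hF', h2, LinearMap.id_apply, sub_self]
  · refine Subtype.ext (sub_eq_zero.1 (eq_zero_of_lin_eq_zero hn ?_))
    rw [map_sub, LinearMap.comp_apply, hF', h2, hF, ← h1, LinearMap.id_apply, sub_self]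

/-- A bounded sequence whose increments converge has increments tending to zero (Cesàro). -/
theorem eq_zero_of_tendsto_increment {E : Type*} [NormedAddCommGroup E] [NormedSpace ℝ E]
    {y : ℕ → E} {c : E} {C : ℝ} (hC : ∀ n, ‖y n‖ ≤ C)
    (h : Tendsto (fun n => y (n + 1) - y n) atTop (𝓝 c)) : c = 0 := by
  have h1 := h.cesaro_smul
  refine tendsto_nhds_unique h1 ?_
  have h2 : Tendsto (fun n : ℕ => (n : ℝ)⁻¹ * (C + C)) atTop (𝓝 0) := by
    simpa using tendsto_inv_atTop_nhds_zero_nat.mul_const (C + C)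
  refine squeeze_zero_norm (fun n => ?_) h2
  rw [Finset.sum_range_sub, norm_smul, norm_inv, Real.norm_natCast]
  gcongr
  exact norm_sub_le_of_le (hC _) (hC _)

/-- The increments of `u_+^1(n)^* u_-^1(n) χ` converge at `+∞` to a multiple of
`W(u_+^1, u_-^1) χ`, which vanishes if `u_-^1 χ` is bounded. -/
theorem mem_spaceL_of_bounded (hV : ∀ n, (V n).IsHermitian) (hmom : FiniteFirstMoment V)
    {χ : Vec L} {C : ℝ} (hC : ∀ n, ‖lin (jostMinus V 1 n) χ‖ ≤ C) : χ ∈ spaceL V := by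
  obtain ⟨hp, hpt⟩ := jostPlus_one_spec hV hmom
  obtain ⟨hm, -⟩ := jostMinus_one_spec hV hmom
  set p : ℤ → Mat L := jostPlus V 1
  set D : ℤ → Vec L := fun n => lin (jostMinus V 1 n) χ
  have hpn : Tendsto (fun n : ℕ => p n) atTop (𝓝 1) := hpt.comp tendsto_natCast_atTop_atTop
  have hpn1 : Tendsto (fun n : ℕ => p (n + 1)) atTop (𝓝 1) := by
    simpa [Function.comp_def] using hpn.comp (tendsto_add_atTop_nat 1)
  have hd : Tendsto (fun n : ℕ => ‖p (n + 1) - p n‖) atTop (𝓝 0) := by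
    simpa using (hpn1.sub hpn).norm
  obtain ⟨B, hB⟩ := (hpn.norm).bddAbove_range
  have hW : ∀ n : ℤ, lin (p n)ᴴ (D (n + 1)) - lin (p (n + 1))ᴴ (D n)
      = Complex.I • lin (wPlusMinus V) χ := by
    intro n
    rw [wPlusMinus, ← wronskianAt_one_eq hV hp hm n, wronskianAt, lin_smul, lin_sub, lin_mul,
      lin_mul, smul_smul, Complex.I_mul_I, neg_one_smul, neg_sub]
  have hinc : Tendsto (fun n : ℕ => lin (p (n + 1 : ℕ))ᴴ (D (n + 1 : ℕ)) - lin (p n)ᴴ (D n)) atTop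
      (𝓝 (Complex.I • lin (wPlusMinus V) χ)) := by
    have e : ∀ n : ℕ, lin (p (n + 1 : ℕ))ᴴ (D (n + 1 : ℕ)) - lin (p n)ᴴ (D n)
        = Complex.I • lin (wPlusMinus V) χ + (lin (p (n + 1) - p n)ᴴ (D (n + 1))
          + lin (p (n + 1) - p n)ᴴ (D n)) := by
      intro n
      rw [← hW n]
      push_cast
      simp only [Matrix.conjTranspose_sub, lin_sub]
      abel
    have h0 : ∀ D' : ℕ → Vec L, (∀ n, ‖D' n‖ ≤ C) →
        Tendsto (fun n : ℕ => lin (p (n + 1) - p n)ᴴ (D' n)) atTop (𝓝 0) := by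
      intro D' hD'
      refine squeeze_zero_norm (a := fun n : ℕ => ‖p (n + 1) - p n‖ * C) (fun n => ?_) ?_
      · refine (norm_lin_le _ _).trans ?_
        rw [Matrix.l2_opNorm_conjTranspose]
        exact mul_le_mul_of_nonneg_left (hD' n) (norm_nonneg _)
      · simpa using hd.mul_const C
    have := (tendsto_const_nhds (x := Complex.I • lin (wPlusMinus V) χ)).add
      ((h0 (fun n => D (n + 1)) fun n => hC _).add (h0 (fun n => D n) fun n => hC _))
    rw [add_zero, add_zero] at this
    exact this.congr fun n => (e n).symm
  have hz := eq_zero_of_tendsto_increment (y := fun n : ℕ => lin (p n)ᴴ (D n)) (C := B * C)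
    (fun n => by
      refine (norm_lin_le _ _).trans ?_
      rw [Matrix.l2_opNorm_conjTranspose]
      have := hB ⟨n, rfl⟩
      exact mul_le_mul this (hC _) (norm_nonneg _) ((norm_nonneg _).trans this)) hinc
  exact (smul_eq_zero_iff_right Complex.I_ne_zero).1 hz

theorem spaceL_reflect (hV : ∀ n, (V n).IsHermitian) (hmom : FiniteFirstMoment V) :
    spaceL (reflect V) = spaceN V := by
  have h1 : jostMinus (reflect V) 1 = reflect (jostPlus V 1) := by
    rw [jostMinus_one_eq (isHermitian_reflect hV) hmom.reflect, reflect_reflect]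
  have h2 : jostPlus (reflect V) 1 = reflect (jostMinus V 1) := by
    rw [jostMinus_one_eq hV hmom, reflect_reflect]
  have h3 : wPlusMinus (reflect V) = -wMinusPlus V := by
    rw [wPlusMinus, wronskian, h1, h2, wronskianAt_reflect,
      wronskianAt_one_eq hV (jostMinus_one_spec hV hmom).1 (jostPlus_one_spec hV hmom).1,
      wMinusPlus]
  ext x
  simp [spaceL, spaceN, h3]

theorem bounded_of_tendsto {E : Type*} [NormedAddCommGroup E] {f : ℤ → E} {a b : E}
    (h1 : Tendsto f atTop (𝓝 a)) (h2 : Tendsto f atBot (𝓝 b)) : ∃ C : ℝ, ∀ n, ‖f n‖ ≤ C := by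
  have : IsBoundedUnder (· ≤ ·) cofinite fun n => ‖f n‖ := by
    rw [Int.cofinite_eq, IsBoundedUnder, map_sup]
    exact isBounded_sup h2.norm.isBoundedUnder_le h1.norm.isBoundedUnder_le
  obtain ⟨C, hC⟩ := this.bddAbove_range_of_cofinite
  exact ⟨C, fun n => hC ⟨n, rfl⟩⟩

theorem tendsto_lin_jostPlus_atTop (hV : ∀ n, (V n).IsHermitian) (hmom : FiniteFirstMoment V)
    (ξ : Vec L) : Tendsto (fun n => lin (jostPlus V 1 n) ξ) atTop (𝓝 ξ) := by
  simpa only [lin_one] using tendsto_lin (jostPlus_one_spec hV hmom).2 ξ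

theorem tendsto_lin_jostMinus_atBot (hV : ∀ n, (V n).IsHermitian) (hmom : FiniteFirstMoment V)
    (χ : Vec L) : Tendsto (fun n => lin (jostMinus V 1 n) χ) atBot (𝓝 χ) := by
  simpa only [lin_one] using tendsto_lin (jostMinus_one_spec hV hmom).2 χ

theorem mem_spaceL_iff_bounded (hV : ∀ n, (V n).IsHermitian) (hmom : FiniteFirstMoment V)
    (χ : Vec L) : χ ∈ spaceL V ↔ ∃ C : ℝ, ∀ n, ‖lin (jostMinus V 1 n) χ‖ ≤ C := by
  refine ⟨fun hχ => ?_, fun ⟨C, hC⟩ => mem_spaceL_of_bounded hV hmom hC⟩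
  obtain ⟨G, hG⟩ := exists_gamma hV hmom
  refine bounded_of_tendsto (a := (G.symm ⟨χ, hχ⟩ : Vec L)) ?_
    (tendsto_lin_jostMinus_atBot hV hmom χ)
  refine (tendsto_lin_jostPlus_atTop hV hmom (G.symm ⟨χ, hχ⟩ : Vec L)).congr fun n => ?_
  rw [hG, LinearEquiv.apply_symm_apply]

theorem mem_spaceN_iff_bounded (hV : ∀ n, (V n).IsHermitian) (hmom : FiniteFirstMoment V)
    (ξ : Vec L) : ξ ∈ spaceN V ↔ ∃ C : ℝ, ∀ n, ‖lin (jostPlus V 1 n) ξ‖ ≤ C := by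
  rw [← spaceL_reflect hV hmom, mem_spaceL_iff_bounded (isHermitian_reflect hV) hmom.reflect,
    jostMinus_one_eq (isHermitian_reflect hV) hmom.reflect, reflect_reflect]
  refine exists_congr fun C => ⟨fun h n => ?_, fun h n => h _⟩
  simpa using h (-n)

theorem hasSum_int_of_telescoping {E : Type*} [NormedAddCommGroup E] [CompleteSpace E]
    {f φ : ℤ → E} {a b : E}
    (hs : Summable f) (hf : ∀ n, f n = φ n - φ (n - 1)) (ha : Tendsto φ atTop (𝓝 a))
    (hb : Tendsto φ atBot (𝓝 b)) : HasSum f (a - b) := by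
  have h1 : HasSum (fun n : ℕ => f n) (a - φ (-1)) := by
    refine ((hs.comp_injective (i := ((↑) : ℕ → ℤ)) Nat.cast_injective).hasSum_iff_tendsto_nat).2 ?_
    have ht : Tendsto (fun n : ℕ => φ ((n : ℤ) - 1)) atTop (𝓝 a) :=
      ha.comp (tendsto_atTop_add_const_right _ (-1) tendsto_natCast_atTop_atTop)
    refine (ht.sub_const (φ (-1))).congr fun n => ?_
    have := Finset.sum_range_sub (fun n : ℕ => φ ((n : ℤ) - 1)) n
    simp only [Nat.cast_zero, zero_sub] at this
    rw [← this]
    refine Finset.sum_congr rfl fun k _ => ?_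
    simp [hf]
  have h2 : HasSum (fun n : ℕ => f (-((n : ℤ) + 1))) (φ (-1) - b) := by
    have hinj : Function.Injective fun n : ℕ => -((n : ℤ) + 1) := fun m n h => by
      simpa using h
    refine ((hs.comp_injective hinj).hasSum_iff_tendsto_nat).2 ?_
    have ht : Tendsto (fun n : ℕ => φ (-((n : ℤ) + 1))) atTop (𝓝 b) :=
      hb.comp (tendsto_neg_atTop_atBot.comp
        (tendsto_atTop_add_const_right _ 1 tendsto_natCast_atTop_atTop))
    refine (ht.const_sub (φ (-1))).congr fun n => ?_
    have := Finset.sum_range_sub' (fun n : ℕ => φ (-((n : ℤ) + 1))) n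
    simp only [Nat.cast_zero, zero_add] at this
    rw [← this]
    refine Finset.sum_congr rfl fun k _ => ?_
    simp only [Function.comp_apply, hf]
    congr 2
  simpa using h1.of_nat_of_neg_add_one h2

theorem tendsto_mul_increment_jostMinus (hV : ∀ n, (V n).IsHermitian) (hmom : FiniteFirstMoment V) :
    Tendsto (fun n : ℤ => (n : ℂ) • (jostMinus V 1 (n + 1) - jostMinus V 1 n)) atBot (𝓝 0) := by
  have h := tendsto_mul_increment_jostPlus (isHermitian_reflect hV) hmom.reflect
  have hp := (jostPlus_one_spec (isHermitian_reflect hV) hmom.reflect).2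
  have ht : Tendsto (fun n : ℤ => -n - 1) atBot atTop :=
    tendsto_atTop_add_const_right _ (-1) tendsto_neg_atBot_atTop
  have h1 : Tendsto (fun n : ℤ => -n) atBot atTop := tendsto_neg_atBot_atTop
  have := (h.comp ht).add ((hp.comp h1).sub (hp.comp ht))
  rw [sub_self, add_zero] at this
  refine this.congr fun n => ?_
  rw [jostMinus_one_eq hV hmom]
  simp only [Function.comp_apply, reflect_apply, sub_add_cancel, neg_add']
  push_cast
  module

/-- The defining series of `Γ`, by summation by parts from `V u = -Δ² u`. -/
theorem hasSum_gamma (hV : ∀ n, (V n).IsHermitian) (hmom : FiniteFirstMoment V) {ξ χ : Vec L}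
    (h : ∀ n, lin (jostPlus V 1 n) ξ = lin (jostMinus V 1 n) χ) :
    HasSum (fun j : ℤ => (j : ℂ) • lin (V j * jostPlus V 1 j) ξ) (ξ - χ) := by
  have h1 := tendsto_lin_jostPlus_atTop hV hmom ξ
  have h2 : Tendsto (fun n => lin (jostPlus V 1 n) ξ) atBot (𝓝 χ) := by
    simpa only [h] using tendsto_lin_jostMinus_atBot hV hmom χ
  obtain ⟨C, hC⟩ := bounded_of_tendsto h1 h2
  have hs : Summable fun j : ℤ => (j : ℂ) • lin (V j * jostPlus V 1 j) ξ := by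
    refine Summable.of_norm_bounded (hmom.summable_norm.mul_right C) fun j => ?_
    rw [norm_smul, Complex.norm_intCast, mul_assoc, lin_mul]
    refine mul_le_mul_of_nonneg_left ((norm_lin_le _ _).trans ?_) (abs_nonneg _)
    exact mul_le_mul_of_nonneg_left (hC j) (norm_nonneg _)
  have hlim := hasSum_int_of_telescoping (a := ξ) (b := χ) (φ := fun j : ℤ =>
    lin (jostPlus V 1 j) ξ - lin ((j : ℂ) • (jostPlus V 1 (j + 1) - jostPlus V 1 j)) ξ) hs ?_ ?_ ?_
  · exact hlim
  · intro j
    have hj := congrArg (fun A => lin A ξ) ((jostPlus_one_spec hV hmom).1 j)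
    simp only [hamiltonian, inv_one, lin_add, lin_smul] at hj
    simp only [lin_smul, lin_sub, sub_add_cancel, Int.cast_sub, Int.cast_one]
    rw [← sub_eq_iff_eq_add'.2 hj.symm]
    module
  · simpa using h1.sub (tendsto_lin (tendsto_mul_increment_jostPlus hV hmom) ξ)
  · have := h2.sub (tendsto_lin (tendsto_mul_increment_jostMinus hV hmom) χ)
    rw [lin_zero, sub_zero] at this
    refine this.congr fun j => ?_
    simp only [lin_smul, lin_sub, h]

end HalfBound

/-! ### Ranges, kernels and algebraic identities -/

section Algebra

theorem ker_lin_conjTranspose (A : Mat L) :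
    LinearMap.ker (lin Aᴴ) = (LinearMap.range (lin A))ᗮ := by
  rw [lin, lin, Matrix.toEuclideanLin_conjTranspose_eq_adjoint, LinearMap.orthogonal_range]

theorem range_lin_conjTranspose (A : Mat L) :
    LinearMap.range (lin Aᴴ) = (LinearMap.ker (lin A))ᗮ := by
  rw [lin, lin, Matrix.toEuclideanLin_conjTranspose_eq_adjoint, LinearMap.orthogonal_ker]

theorem lin_extendMat {K K' : Submodule ℂ (Vec L)} (G : K →ₗ[ℂ] K') (x : Vec L) :
    lin (extendMat G) x = (G (K.orthogonalProjectionOnto x) : Vec L) := by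
  simp [extendMat]

theorem lin_extendMat_of_mem {K K' : Submodule ℂ (Vec L)} (G : K →ₗ[ℂ] K') (x : K) :
    lin (extendMat G) (x : Vec L) = (G x : Vec L) := by
  rw [lin_extendMat, Submodule.orthogonalProjectionOnto_mem_subspace_eq_self]

theorem extendMat_mul_projMat {K K' : Submodule ℂ (Vec L)} (G : K →ₗ[ℂ] K') :
    extendMat G * projMat K = extendMat G := lin_ext fun x => by
  rw [lin_mul, lin_projMat, ← Submodule.coe_orthogonalProjectionOnto_apply, lin_extendMat_of_mem,
    lin_extendMat]

theorem projMat_mul_of_range_le {K : Submodule ℂ (Vec L)} {T : Mat L}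
    (hT : LinearMap.range (lin T) = K) : projMat K * T = T := lin_ext fun x => by
  rw [lin_mul, lin_projMat, Submodule.starProjection_eq_self_iff.2]
  exact hT ▸ LinearMap.mem_range_self _ x

theorem range_extendMat_mul {K K' : Submodule ℂ (Vec L)} (G : K ≃ₗ[ℂ] K') {T : Mat L}
    (hT : LinearMap.range (lin T) = K) :
    LinearMap.range (lin (extendMat G.toLinearMap * T)) = K' := by
  ext y
  constructor
  · rintro ⟨x, rfl⟩
    rw [lin_mul, lin_extendMat]
    exact Subtype.coe_prop _
  · intro hy
    obtain ⟨x, hx⟩ : (G.symm ⟨y, hy⟩ : Vec L) ∈ LinearMap.range (lin T) := by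
      rw [hT]
      exact Subtype.coe_prop _
    refine ⟨x, ?_⟩
    rw [lin_mul, hx, lin_extendMat_of_mem, LinearEquiv.coe_coe, LinearEquiv.apply_symm_apply]

theorem ker_extendMat_mul {K K' : Submodule ℂ (Vec L)} (G : K ≃ₗ[ℂ] K') {T : Mat L}
    (hT : LinearMap.range (lin T) = K) :
    LinearMap.ker (lin (extendMat G.toLinearMap * T)) = LinearMap.ker (lin T) := by
  ext x
  have hx : lin T x ∈ K := hT ▸ LinearMap.mem_range_self _ x
  rw [LinearMap.mem_ker, LinearMap.mem_ker, lin_mul, lin_extendMat_of_mem _ ⟨_, hx⟩]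
  simp

/-- The Wronskian of `v` and `w` computed at a site where the auxiliary isotropic solution `u` is
invertible. -/
theorem wronskianAt_eq_add {u v w : ℤ → Mat L} {n : ℤ} (hu : IsUnit (u n))
    (huu : wronskianAt u u n = 0) :
    wronskianAt v w n = wronskianAt v u n * ((u n)⁻¹ * w n)
      + (v n)ᴴ * (u n)⁻¹ᴴ * wronskianAt u w n := by
  have h1 := Matrix.mul_nonsing_inv _ ((Matrix.isUnit_iff_isUnit_det _).1 hu)
  have h2 : (u n)⁻¹ᴴ * (u n)ᴴ = 1 := by
    rw [← Matrix.conjTranspose_mul, h1, Matrix.conjTranspose_one]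
  rw [wronskianAt, smul_eq_zero_iff_right Complex.I_ne_zero, sub_eq_zero] at huu
  have h3 : u (n + 1) * (u n)⁻¹ = (u n)⁻¹ᴴ * (u (n + 1))ᴴ := by
    calc u (n + 1) * (u n)⁻¹ = (u n)⁻¹ᴴ * ((u n)ᴴ * u (n + 1)) * (u n)⁻¹ := by
          rw [← mul_assoc, h2, one_mul]
      _ = (u n)⁻¹ᴴ * (u (n + 1))ᴴ := by rw [← huu, mul_assoc, mul_assoc, h1, mul_one]
  simp only [wronskianAt, Matrix.smul_mul, Matrix.mul_smul, ← smul_add]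
  congr 1
  have e1 : (v (n + 1))ᴴ * u n * ((u n)⁻¹ * w n) = (v (n + 1))ᴴ * w n := by
    rw [mul_assoc, ← mul_assoc (u n), h1, one_mul]
  have e2 : (v n)ᴴ * u (n + 1) * ((u n)⁻¹ * w n) = (v n)ᴴ * (u n)⁻¹ᴴ * ((u (n + 1))ᴴ * w n) := by
    rw [mul_assoc, ← mul_assoc (u (n + 1)), h3]
    simp only [mul_assoc]
  have e3 : (v n)ᴴ * (u n)⁻¹ᴴ * ((u n)ᴴ * w (n + 1)) = (v n)ᴴ * w (n + 1) := by
    rw [mul_assoc, ← mul_assoc _ (u n)ᴴ, h2, one_mul]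
  rw [sub_mul, mul_sub, e1, e2, e3]
  abel

theorem nu_star (z : ℂ) : star (nu (star z)) = -nu z := by
  simp only [nu, star_div₀, star_sub, star_inv₀, Complex.star_def, Complex.conj_I,
    Complex.conj_conj, neg_div]

/-- `M_-^z = (M_+^{z̄})^*`, so that all statements on `M_-` and `T_-` in the disk follow from those
on `M_+` and `T_+`. -/
theorem MMinus_eq (z : ℂ) : MMinus V z = (MPlus V (star z))ᴴ := by
  rw [MMinus, MPlus, Matrix.conjTranspose_smul, nu_star, star_star, wronskian, wronskian,
    conjTranspose_wronskianAt]

theorem TMinus_eq (z : ℂ) : TMinus V z = (TPlus V (star z))ᴴ := by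
  rw [TMinus, TPlus, MMinus_eq, Matrix.conjTranspose_nonsing_inv]

end Algebra

/-! ### The limit matrix at the band edge -/

section BandEdgeMatrix

variable {G : spaceN V ≃ₗ[ℂ] spaceL V} {m : ℤ}

/-- The matrix `(Ω^* + Γ) P_𝒩 + W(u_-^1, u_+^1)`, whose inverse, cut off by `2 P_𝒩`, is the
transmission coefficient at the band edge. -/
noncomputable def limitMat (V : ℤ → Mat L) (m : ℤ) (G : spaceN V →ₗ[ℂ] spaceL V) : Mat L :=
  ((Omega V m)ᴴ + extendMat G) * projMat (spaceN V) + wMinusPlus V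

theorem lin_limitMat (m : ℤ) (G : spaceN V →ₗ[ℂ] spaceL V) (x : Vec L) :
    lin (limitMat V m G) x = lin ((Omega V m)ᴴ + extendMat G) ((spaceN V).starProjection x)
      + lin (wMinusPlus V) x := by
  rw [limitMat, lin_add, lin_mul, lin_projMat]

theorem inner_lin_wMinusPlus {χ : Vec L} (hχ : χ ∈ spaceL V) (x : Vec L) :
    inner ℂ χ (lin (wMinusPlus V) x) = 0 := by
  rw [← conjTranspose_wPlusMinus, ← inner_lin]
  have : lin (wPlusMinus V) χ = 0 := hχ
  rw [this, inner_zero_left]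

/-- `⟨Γξ, (Ω^* + Γ) ξ⟩ = ‖ξ‖² + ‖Γξ‖²`, because `Ω` inverts `Γ`; this is what makes the band edge
matrix invertible. -/
theorem inner_gamma (hG : ∀ (ξ : spaceN V) (n : ℤ),
      lin (jostPlus V 1 n) (ξ : Vec L) = lin (jostMinus V 1 n) (G ξ : Vec L))
    (hm : IsUnit (jostPlus V 1 m)) (ξ : spaceN V) :
    inner ℂ (G ξ : Vec L) (lin ((Omega V m)ᴴ + extendMat G.toLinearMap) (ξ : Vec L))
      = ((‖(ξ : Vec L)‖ ^ 2 + ‖(G ξ : Vec L)‖ ^ 2 : ℝ) : ℂ) := by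
  have h1 : lin (Omega V m) (G ξ : Vec L) = ξ := by
    rw [Omega, lin_mul, ← hG, ← lin_mul,
      Matrix.nonsing_inv_mul _ ((Matrix.isUnit_iff_isUnit_det _).1 hm), lin_one]
  rw [lin_add, inner_add_right, ← inner_lin, h1, lin_extendMat_of_mem, LinearEquiv.coe_coe,
    inner_self_eq_norm_sq_to_K, inner_self_eq_norm_sq_to_K]
  push_cast
  rfl

theorem eq_zero_of_inner_gamma_eq_zero (hG : ∀ (ξ : spaceN V) (n : ℤ),
      lin (jostPlus V 1 n) (ξ : Vec L) = lin (jostMinus V 1 n) (G ξ : Vec L))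
    (hm : IsUnit (jostPlus V 1 m)) {ξ : spaceN V}
    (h : inner ℂ (G ξ : Vec L) (lin ((Omega V m)ᴴ + extendMat G.toLinearMap) (ξ : Vec L)) = 0) :
    (ξ : Vec L) = 0 := by
  rw [inner_gamma hG hm, Complex.ofReal_eq_zero] at h
  have : ‖(ξ : Vec L)‖ ^ 2 = 0 := by
    linarith [sq_nonneg ‖(ξ : Vec L)‖, sq_nonneg ‖(G ξ : Vec L)‖]
  simpa using this

theorem isUnit_of_lin_injective {A : Mat L} (h : ∀ x, lin A x = 0 → x = 0) : IsUnit A := by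
  refine Matrix.mulVec_injective_iff_isUnit.1 fun x y hxy => ?_
  have h1 := h (WithLp.toLp 2 (x - y)) (by
    simp only [Matrix.toLpLin_apply, Matrix.mulVec_sub, hxy, sub_self]
    rfl)
  rw [WithLp.toLp_eq_zero] at h1
  exact sub_eq_zero.1 h1

theorem isUnit_limitMat (hG : ∀ (ξ : spaceN V) (n : ℤ),
      lin (jostPlus V 1 n) (ξ : Vec L) = lin (jostMinus V 1 n) (G ξ : Vec L))
    (hm : IsUnit (jostPlus V 1 m)) : IsUnit (limitMat V m G.toLinearMap) := by
  refine isUnit_of_lin_injective fun x hx => ?_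
  set ξ : spaceN V := (spaceN V).orthogonalProjectionOnto x
  have hξ : (spaceN V).starProjection x = ξ := rfl
  rw [lin_limitMat, hξ] at hx
  have h0 : (ξ : Vec L) = 0 := by
    refine eq_zero_of_inner_gamma_eq_zero hG hm ?_
    have := congrArg (fun y => inner ℂ (G ξ : Vec L) y) hx
    simpa only [inner_add_right, inner_lin_wMinusPlus (G ξ).2, add_zero, inner_zero_right]
      using this
  rw [h0, map_zero, zero_add] at hx
  rwa [← hξ, Submodule.starProjection_eq_self_iff.2 (show x ∈ spaceN V from hx)] at h0

theorem lin_inv_lin {A : Mat L} (hA : IsUnit A) (x : Vec L) : lin A⁻¹ (lin A x) = x := by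
  rw [← lin_mul, Matrix.nonsing_inv_mul _ ((Matrix.isUnit_iff_isUnit_det _).1 hA), lin_one]

theorem lin_lin_inv {A : Mat L} (hA : IsUnit A) (x : Vec L) : lin A (lin A⁻¹ x) = x := by
  rw [← lin_mul, Matrix.mul_nonsing_inv _ ((Matrix.isUnit_iff_isUnit_det _).1 hA), lin_one]

theorem range_transmission (hY : IsUnit (limitMat V m G.toLinearMap)) :
    LinearMap.range (lin ((2 : ℂ) • (projMat (spaceN V) * (limitMat V m G.toLinearMap)⁻¹)))
      = spaceN V := by
  ext y
  constructor
  · rintro ⟨x, rfl⟩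
    rw [lin_smul, lin_mul, lin_projMat]
    exact Submodule.smul_mem _ _ (Submodule.starProjection_apply_mem _ _)
  · intro hy
    refine ⟨lin (limitMat V m G.toLinearMap) ((2 : ℂ)⁻¹ • y), ?_⟩
    rw [lin_smul, lin_mul, lin_inv_lin hY, lin_projMat, map_smul,
      Submodule.starProjection_eq_self_iff.2 hy, smul_smul, mul_inv_cancel₀ two_ne_zero, one_smul]

theorem ker_transmission (hY : IsUnit (limitMat V m G.toLinearMap)) :
    LinearMap.ker (lin ((2 : ℂ) • (projMat (spaceN V) * (limitMat V m G.toLinearMap)⁻¹)))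
      = LinearMap.range (lin (wMinusPlus V)) := by
  ext y
  rw [LinearMap.mem_ker, lin_smul, smul_eq_zero_iff_right two_ne_zero, lin_mul, lin_projMat]
  constructor
  · intro h
    refine ⟨lin (limitMat V m G.toLinearMap)⁻¹ y, ?_⟩
    conv_rhs => rw [← lin_lin_inv hY y, lin_limitMat, h, map_zero, zero_add]
  · rintro ⟨x, rfl⟩
    have hmem := (spaceN V).starProjection_apply_mem x
    have h1 : (spaceN V).starProjection (x - (spaceN V).starProjection x) = 0 := by
      rw [map_sub, Submodule.starProjection_eq_self_iff.2 hmem, sub_self]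
    have h2 : lin (wMinusPlus V) x
        = lin (limitMat V m G.toLinearMap) (x - (spaceN V).starProjection x) := by
      have h3 : lin (wMinusPlus V) ((spaceN V).starProjection x) = 0 := hmem
      rw [lin_limitMat, h1, map_zero, zero_add, map_sub, h3, sub_zero]
    rw [h2, lin_inv_lin hY, h1]

variable {d d' : ℕ}

theorem starProjection_eq_sum {K : Submodule ℂ (Vec L)}
    (v : OrthonormalBasis (Fin d ⊕ Fin d') ℂ (Vec L)) (h1 : ∀ i, v (Sum.inl i) ∈ K)
    (h2 : ∀ i, v (Sum.inr i) ∈ Kᗮ) (x : Vec L) :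
    K.starProjection x = ∑ i, (inner ℂ (v (Sum.inl i)) x : ℂ) • v (Sum.inl i) := by
  conv_lhs => rw [← v.sum_repr' x]
  rw [map_sum, Fintype.sum_sum_type]
  simp only [map_smul, Submodule.starProjection_eq_self_iff.2 (h1 _),
    (Submodule.starProjection_apply_eq_zero_iff _).2 (h2 _), smul_zero, Finset.sum_const_zero,
    add_zero]

theorem edgeMatrix_apply (G : spaceN V →ₗ[ℂ] spaceL V)
    (v e : OrthonormalBasis (Fin d ⊕ Fin d') ℂ (Vec L)) (hv : ∀ i, v (Sum.inl i) ∈ spaceN V)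
    (he : ∀ i, e (Sum.inl i) ∈ spaceL V) (i k : Fin d) :
    edgeMatrix V m G v e i k = inner ℂ (e (Sum.inl i))
      (lin ((Omega V m)ᴴ + extendMat G) (v (Sum.inl k))) := by
  rw [edgeMatrix, Matrix.of_apply, ← Submodule.inner_starProjection_left_eq_right,
    Submodule.starProjection_eq_self_iff.2 (he i), Submodule.starProjection_eq_self_iff.2 (hv k)]

theorem inner_eq_edgeMatrix_mulVec (G : spaceN V →ₗ[ℂ] spaceL V)
    (v e : OrthonormalBasis (Fin d ⊕ Fin d') ℂ (Vec L)) (hv : ∀ i, v (Sum.inl i) ∈ spaceN V)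
    (he : ∀ i, e (Sum.inl i) ∈ spaceL V) (c : Fin d → ℂ) (i : Fin d) :
    inner ℂ (e (Sum.inl i))
      (lin ((Omega V m)ᴴ + extendMat G) (∑ k, c k • v (Sum.inl k)))
      = (edgeMatrix V m G v e *ᵥ c) i := by
  rw [map_sum, inner_sum, Matrix.mulVec, dotProduct]
  refine Finset.sum_congr rfl fun k _ => ?_
  rw [map_smul, inner_smul_right, edgeMatrix_apply G v e hv he, mul_comm]

theorem isUnit_edgeMatrix (hG : ∀ (ξ : spaceN V) (n : ℤ),
      lin (jostPlus V 1 n) (ξ : Vec L) = lin (jostMinus V 1 n) (G ξ : Vec L))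
    (hm : IsUnit (jostPlus V 1 m)) (v e : OrthonormalBasis (Fin d ⊕ Fin d') ℂ (Vec L))
    (hv : ∀ i, v (Sum.inl i) ∈ spaceN V) (he : ∀ i, e (Sum.inl i) ∈ spaceL V)
    (he' : ∀ i, e (Sum.inr i) ∈ (spaceL V)ᗮ) : IsUnit (edgeMatrix V m G.toLinearMap v e) := by
  refine Matrix.mulVec_injective_iff_isUnit.1 ((injective_iff_map_eq_zero
    (Matrix.mulVecLin (edgeMatrix V m G.toLinearMap v e))).2 fun c hc => ?_)
  set x : Vec L := ∑ k, c k • v (Sum.inl k)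
  have hx : x ∈ spaceN V := Submodule.sum_mem _ fun k _ => Submodule.smul_mem _ _ (hv k)
  have h0 : x = 0 := by
    refine eq_zero_of_inner_gamma_eq_zero hG hm (ξ := ⟨x, hx⟩) ?_
    have hsum := starProjection_eq_sum e he he' (G ⟨x, hx⟩ : Vec L)
    rw [Submodule.starProjection_eq_self_iff.2 (G ⟨x, hx⟩).2] at hsum
    rw [hsum, sum_inner]
    refine Finset.sum_eq_zero fun i _ => ?_
    rw [inner_smul_left, inner_eq_edgeMatrix_mulVec _ v e hv he]
    have := congrFun hc i
    rw [Matrix.mulVecLin_apply] at this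
    rw [this, Pi.zero_apply, mul_zero]
  funext k
  have hli : Orthonormal ℂ fun k => v (Sum.inl k) := v.orthonormal.comp _ Sum.inl_injective
  have := hli.inner_right_fintype c k
  rw [← this, Pi.zero_apply]
  change inner ℂ _ x = 0
  rw [h0, inner_zero_right]

/-- `Q diag(2 A⁻¹, 0) P` in coordinates. -/
theorem lin_edgeTransmission (G : spaceN V →ₗ[ℂ] spaceL V)
    (v e : OrthonormalBasis (Fin d ⊕ Fin d') ℂ (Vec L)) (y : Vec L) :
    lin (edgeTransmission V m G v e) y = ∑ k, (2 * ((edgeMatrix V m G v e)⁻¹ *ᵥ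
      fun i => inner ℂ (e (Sum.inl i)) y) k) • v (Sum.inl k) := by
  have he : (columnMat e)ᴴ *ᵥ y.ofLp = fun i => inner ℂ (e i) y := by
    funext i
    simp only [Matrix.mulVec, dotProduct, Matrix.conjTranspose_apply, columnMat, Matrix.of_apply,
      PiLp.inner_apply, RCLike.inner_apply, Complex.star_def]
    exact Finset.sum_congr rfl fun j _ => mul_comm _ _
  ext j
  simp only [edgeTransmission, Matrix.toLpLin_apply, ← Matrix.mulVec_mulVec, he,
    Matrix.fromBlocks_mulVec, Matrix.zero_mulVec, add_zero, Matrix.smul_mulVec]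
  simp only [Matrix.mulVec, dotProduct, columnMat, Matrix.of_apply, Fintype.sum_sum_type,
    Sum.elim_inl, Sum.elim_inr, Pi.zero_apply, mul_zero, Finset.sum_const_zero, add_zero,
    WithLp.ofLp_sum, Finset.sum_apply, smul_eq_mul, Pi.smul_apply,
    WithLp.ofLp_smul, Function.comp_def]
  exact Finset.sum_congr rfl fun j _ => mul_comm _ _

/-- The basis-dependent description of the band edge transmission coefficient agrees with
`2 P_𝒩 Y⁻¹`. -/
theorem edgeTransmission_eq (hG : ∀ (ξ : spaceN V) (n : ℤ),
      lin (jostPlus V 1 n) (ξ : Vec L) = lin (jostMinus V 1 n) (G ξ : Vec L))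
    (hm : IsUnit (jostPlus V 1 m)) (v e : OrthonormalBasis (Fin d ⊕ Fin d') ℂ (Vec L))
    (hv : ∀ i, v (Sum.inl i) ∈ spaceN V) (hv' : ∀ i, v (Sum.inr i) ∈ (spaceN V)ᗮ)
    (he : ∀ i, e (Sum.inl i) ∈ spaceL V) (he' : ∀ i, e (Sum.inr i) ∈ (spaceL V)ᗮ) :
    (2 : ℂ) • (projMat (spaceN V) * (limitMat V m G.toLinearMap)⁻¹)
      = edgeTransmission V m G.toLinearMap v e := by
  have hY := isUnit_limitMat hG hm
  have hA := isUnit_edgeMatrix hG hm v e hv he he'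
  refine lin_ext fun y => ?_
  obtain ⟨x, rfl⟩ : ∃ x, y = lin (limitMat V m G.toLinearMap) x := ⟨_, (lin_lin_inv hY y).symm⟩
  have h1 : (fun i => inner ℂ (e (Sum.inl i)) (lin (limitMat V m G.toLinearMap) x))
      = edgeMatrix V m G.toLinearMap v e *ᵥ fun k => inner ℂ (v (Sum.inl k)) x := by
    funext i
    rw [lin_limitMat, inner_add_right, inner_lin_wMinusPlus (he i), add_zero,
      starProjection_eq_sum v hv hv', inner_eq_edgeMatrix_mulVec _ v e hv he]
  rw [lin_edgeTransmission, h1, Matrix.mulVec_mulVec,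
    Matrix.nonsing_inv_mul _ ((Matrix.isUnit_iff_isUnit_det _).1 hA), Matrix.one_mulVec, lin_smul,
    lin_mul, lin_inv_lin hY, lin_projMat, starProjection_eq_sum v hv hv', Finset.smul_sum]
  simp only [smul_smul]

end BandEdgeMatrix

/-! ### The limits of the transmission and reflection coefficients -/

section Limits

open scoped Matrix.Norms.L2Operator

theorem tendsto_nonsing_inv {ι : Type*} {l : Filter ι} {A : ι → Mat L} {B : Mat L}
    (hB : IsUnit B) (h : Tendsto A l (𝓝 B)) : Tendsto (fun i => (A i)⁻¹) l (𝓝 B⁻¹) := by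
  obtain ⟨b, rfl⟩ := hB
  simp only [Matrix.nonsing_inv_eq_ringInverse]
  exact (NormedRing.inverse_continuousAt b).tendsto.comp h

theorem jostPlus_mul_projMat {G : spaceN V ≃ₗ[ℂ] spaceL V} (hG : ∀ (ξ : spaceN V) (n : ℤ),
      lin (jostPlus V 1 n) (ξ : Vec L) = lin (jostMinus V 1 n) (G ξ : Vec L)) (n : ℤ) :
    jostPlus V 1 n * projMat (spaceN V) = jostMinus V 1 n * extendMat G.toLinearMap :=
  lin_ext fun x => by
    rw [lin_mul, lin_mul, lin_projMat, lin_extendMat,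
      ← Submodule.coe_orthogonalProjectionOnto_apply, hG]
    rfl

theorem jostMinus_mul_projMat {G : spaceN V ≃ₗ[ℂ] spaceL V} (hG : ∀ (ξ : spaceN V) (n : ℤ),
      lin (jostPlus V 1 n) (ξ : Vec L) = lin (jostMinus V 1 n) (G ξ : Vec L)) (n : ℤ) :
    jostMinus V 1 n * projMat (spaceL V) = jostPlus V 1 n * extendMat G.symm.toLinearMap :=
  lin_ext fun x => by
    rw [lin_mul, lin_mul, lin_projMat, lin_extendMat,
      ← Submodule.coe_orthogonalProjectionOnto_apply, hG, LinearEquiv.coe_coe, LinearEquiv.apply_symm_apply]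

/-- After the change of basis `K = u_+^1(m)⁻¹ u_+^z(m) → 1` and a rescaling by `1 / (i (1 - z))`
on `𝒩`, the Wronskian `W(u_-^{1/z̄}, u_+^z)` has the invertible limit `limitMat`. The factor `K⁻¹`
compensates `u_+^z - u_+^1`, which need not be of order `1 - z`. -/
theorem tendsto_rescaled_wronskian (hV : ∀ n, (V n).IsHermitian) (hmom : FiniteFirstMoment V)
    {G : spaceN V ≃ₗ[ℂ] spaceL V} (hG : ∀ (ξ : spaceN V) (n : ℤ),
      lin (jostPlus V 1 n) (ξ : Vec L) = lin (jostMinus V 1 n) (G ξ : Vec L)) {m : ℤ}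
    (hm : IsUnit (jostPlus V 1 m)) :
    Tendsto (fun z => wronskian (jostMinus V (star z)⁻¹) (jostPlus V z) *
        ((jostPlus V 1 m)⁻¹ * jostPlus V z m)⁻¹ *
        ((Complex.I * (1 - z))⁻¹ • projMat (spaceN V) + (1 - projMat (spaceN V))))
      edgeFilter (𝓝 (limitMat V m G.toLinearMap)) := by
  have hm' := Matrix.nonsing_inv_mul _ ((Matrix.isUnit_iff_isUnit_det _).1 hm)
  set p := jostPlus V 1
  set q := jostMinus V 1
  set P := projMat (spaceN V)
  set K : ℂ → Mat L := fun z => (p m)⁻¹ * jostPlus V z m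
  set Φ : ℂ → Mat L := fun z => (Complex.I * (1 - z))⁻¹ • wronskianAt p (jostPlus V z) m
  set qz : ℂ → ℤ → Mat L := fun z => jostMinus V (star z)⁻¹
  have hK : Tendsto K edgeFilter (𝓝 1) := by
    rw [← hm']
    exact (tendsto_jostPlus_edge hV hmom m).const_mul (p m)⁻¹
  have hKi : Tendsto (fun z => (K z)⁻¹) edgeFilter (𝓝 1) := by
    simpa using tendsto_nonsing_inv isUnit_one hK
  have hΦ : Tendsto Φ edgeFilter (𝓝 1) := tendsto_wronskianAt_jostPlus_edge hV hmom m
  have hqz : ∀ n, Tendsto (fun z => qz z n) edgeFilter (𝓝 (q n)) := fun n =>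
    (tendsto_jostMinus_edge hV hmom n).comp tendsto_star_edgeFilter
  have hqzs : ∀ n, Tendsto (fun z => (qz z n)ᴴ) edgeFilter (𝓝 (q n)ᴴ) := fun n => (hqz n).star
  have hε : Tendsto (fun z : ℂ => Complex.I * (1 - z)) edgeFilter (𝓝 0) := by
    simpa using (tendsto_edgeFilter_nhds.const_sub 1).const_mul Complex.I
  have h1 : Tendsto (fun z => (Complex.I * (1 - z))⁻¹ • wronskianAt (qz z) q m) edgeFilter
      (𝓝 1) := by
    have h0 := ((tendsto_wronskianAt_jostMinus_edge hV hmom m).comp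
      tendsto_star_edgeFilter).star.neg
    rw [star_neg, star_one, neg_neg] at h0
    refine h0.congr fun z => ?_
    rw [Function.comp_apply, Matrix.star_eq_conjTranspose, Matrix.conjTranspose_smul,
      conjTranspose_wronskianAt, ← neg_smul]
    congr 1
    simp only [star_inv₀, star_mul', star_sub, star_one, Complex.star_def, Complex.conj_I,
      Complex.conj_conj, neg_mul, inv_neg, neg_neg]
  have h2 : Tendsto (fun z => wronskianAt (qz z) p m) edgeFilter (𝓝 (wMinusPlus V)) := by
    have := (((hqzs (m + 1)).mul_const (p m)).sub ((hqzs m).mul_const (p (m + 1)))).const_smul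
      Complex.I
    rwa [show wMinusPlus V = wronskianAt q p m from (wronskianAt_one_eq hV
      (jostMinus_one_spec hV hmom).1 (jostPlus_one_spec hV hmom).1 m).symm]
  have hlim := ((h1.mul_const (extendMat G.toLinearMap)).add (h2.mul_const (1 - P))).add
    ((((hqzs m).mul_const (p m)⁻¹ᴴ).mul (hΦ.mul hKi)).mul
      ((tendsto_const_nhds (x := P)).add (hε.smul_const (1 - P))))
  -- On `𝒩`, `u_+^1 ξ = u_-^1 Γ ξ` turns `W(u_-^{1/z̄}, u_+^1) ξ` into
  -- `W(u_-^{1/z̄}, u_-^1) Γ ξ = i (1 - z) (Γ ξ + o(1))`.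
  have hval : (1 : Mat L) * extendMat G.toLinearMap + wMinusPlus V * (1 - P)
      + (q m)ᴴ * (p m)⁻¹ᴴ * (1 * 1) * (P + (0 : ℂ) • (1 - P)) = limitMat V m G.toLinearMap := by
    rw [limitMat, add_mul, extendMat_mul_projMat, mul_sub, wMinusPlus_mul_projMat, Omega,
      Matrix.conjTranspose_mul, zero_smul, add_zero, mul_one, mul_one, one_mul, mul_one, sub_zero]
    abel
  rw [hval] at hlim
  refine hlim.congr' ?_
  filter_upwards [eventually_edgeFilter, eventually_isUnit_of_tendsto_one hK] with z hz hKz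
  have hKz' := Matrix.mul_nonsing_inv _ ((Matrix.isUnit_iff_isUnit_det _).1 hKz)
  have hI : Complex.I * (1 - z) ≠ 0 :=
    mul_ne_zero Complex.I_ne_zero (sub_ne_zero.2 hz.2.1.symm)
  have hqs : IsSolution V (star z) (qz z) := isSolution_inv_iff.1
    (isJostMinus_jostMinus hV hmom (star_ne_zero.2 hz.1) (by rw [norm_star]; exact hz.2.2.2)).1
  have hW : wronskian (qz z) (jostPlus V z)
      = wronskianAt (qz z) p m * K z + (qz z m)ᴴ * (p m)⁻¹ᴴ * ((Complex.I * (1 - z)) • Φ z) := by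
    rw [wronskian, ← wronskianAt_eq hV hqs (isJostPlus_jostPlus hV hmom hz.1 hz.2.2.2).1 m,
      wronskianAt_eq_add hm (wronskianAt_jostPlus_one hV hmom m), smul_smul, mul_inv_cancel₀ hI,
      one_smul]
  have hP : wronskianAt (qz z) p m * P = wronskianAt (qz z) q m * extendMat G.toLinearMap := by
    rw [← wronskianAt_mul_right, ← wronskianAt_mul_right]
    simp only [p, q, P, jostPlus_mul_projMat hG]
  change _ = wronskian (qz z) (jostPlus V z) * (K z)⁻¹ * _
  rw [hW, add_mul _ _ (K z)⁻¹, mul_assoc _ (K z), hKz', mul_one, add_mul,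
    mul_add (wronskianAt (qz z) p m), Matrix.mul_smul (wronskianAt (qz z) p m), hP, Matrix.smul_mul]
  congr 1
  generalize Φ z = φ
  rw [Matrix.mul_smul, Matrix.smul_mul, Matrix.smul_mul, ← Matrix.mul_smul, smul_add, smul_smul,
    mul_inv_cancel₀ hI, one_smul, ← mul_assoc _ φ]

/-- `1 / ν = (1 - z) · i (1 + z) / z`, so it compensates the rescaling on `𝒩` and vanishes on `𝒩^⊥`. -/
theorem tendsto_nu_inv_rescaling (P : Mat L) :
    Tendsto (fun z => (nu z)⁻¹ • ((Complex.I * (1 - z))⁻¹ • P + (1 - P))) edgeFilter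
      (𝓝 ((2 : ℂ) • P)) := by
  have hinv := tendsto_edgeFilter_nhds.inv₀ one_ne_zero
  have h1 : Tendsto (fun z : ℂ => z⁻¹ * (1 + z)) edgeFilter (𝓝 2) := by
    have := hinv.mul (tendsto_edgeFilter_nhds.const_add 1)
    norm_num at this
    exact this
  have h2 : Tendsto (fun z => (nu z)⁻¹) edgeFilter (𝓝 0) := by
    simpa [nu_inv] using (hinv.sub tendsto_edgeFilter_nhds).const_mul Complex.I
  have := (h1.smul_const P).add (h2.smul_const (1 - P))
  rw [zero_smul, add_zero] at this
  refine this.congr' ?_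
  filter_upwards [eventually_edgeFilter] with z hz
  rw [smul_add, smul_smul]
  congr 2
  have h1z : (1 : ℂ) - z ≠ 0 := sub_ne_zero.2 hz.2.1.symm
  have hz0 := hz.1
  have hI := Complex.I_ne_zero
  rw [nu_inv]
  field_simp
  ring

/-- `M_+^z` is invertible near `1`, and `T_+^z` tends to `2 P_𝒩 Y⁻¹`. -/
theorem tendsto_TPlus (hV : ∀ n, (V n).IsHermitian) (hmom : FiniteFirstMoment V)
    {G : spaceN V ≃ₗ[ℂ] spaceL V} (hG : ∀ (ξ : spaceN V) (n : ℤ),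
      lin (jostPlus V 1 n) (ξ : Vec L) = lin (jostMinus V 1 n) (G ξ : Vec L)) {m : ℤ}
    (hm : IsUnit (jostPlus V 1 m)) :
    (∀ᶠ z in edgeFilter, IsUnit (MPlus V z)) ∧
    Tendsto (TPlus V) edgeFilter
      (𝓝 ((2 : ℂ) • (projMat (spaceN V) * (limitMat V m G.toLinearMap)⁻¹))) := by
  have hm' := Matrix.nonsing_inv_mul _ ((Matrix.isUnit_iff_isUnit_det _).1 hm)
  have hY := isUnit_limitMat hG hm
  have hB := tendsto_rescaled_wronskian hV hmom hG hm
  have hBu := hB.eventually (Units.isOpen.mem_nhds hY)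
  have hK : Tendsto (fun z => (jostPlus V 1 m)⁻¹ * jostPlus V z m) edgeFilter (𝓝 1) := by
    simpa [hm'] using (tendsto_jostPlus_edge hV hmom m).const_mul (jostPlus V 1 m)⁻¹
  have hKi : Tendsto (fun z => ((jostPlus V 1 m)⁻¹ * jostPlus V z m)⁻¹) edgeFilter (𝓝 1) := by
    simpa using tendsto_nonsing_inv isUnit_one hK
  have hlim := (hKi.mul (tendsto_nu_inv_rescaling (projMat (spaceN V)))).mul
    (tendsto_nonsing_inv hY hB)
  rw [one_mul, Matrix.smul_mul] at hlim
  have hmul : ∀ᶠ z in edgeFilter, MPlus V z * (((jostPlus V 1 m)⁻¹ * jostPlus V z m)⁻¹ *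
      ((nu z)⁻¹ • ((Complex.I * (1 - z))⁻¹ • projMat (spaceN V) + (1 - projMat (spaceN V)))) *
      (wronskian (jostMinus V (star z)⁻¹) (jostPlus V z) *
        ((jostPlus V 1 m)⁻¹ * jostPlus V z m)⁻¹ *
        ((Complex.I * (1 - z))⁻¹ • projMat (spaceN V) + (1 - projMat (spaceN V))))⁻¹) = 1 := by
    filter_upwards [eventually_edgeFilter, hBu] with z hz hBz
    have hν := nu_ne_zero hz.1 hz.2.1 hz.2.2.1
    have := Matrix.mul_nonsing_inv _ ((Matrix.isUnit_iff_isUnit_det _).1 hBz)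
    rw [← mul_assoc, MPlus, Matrix.mul_smul, Matrix.smul_mul, Matrix.mul_smul, smul_smul,
      mul_inv_cancel₀ hν, one_smul, ← mul_assoc (wronskian _ _)]
    exact this
  refine ⟨hmul.mono fun z hz => IsUnit.of_mul_eq_one _ hz, hlim.congr' ?_⟩
  filter_upwards [hmul] with z hz using (Matrix.inv_eq_right_inv hz).symm

/-- The filter of approach to `1` within the unit circle. -/
noncomputable abbrev circleFilter : Filter ℂ := 𝓝[Metric.sphere (0 : ℂ) 1 \ {1}] (1 : ℂ)

theorem circleFilter_le_edgeFilter : circleFilter ≤ edgeFilter :=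
  nhdsWithin_mono _ (Set.sdiff_subset_sdiff_left Metric.sphere_subset_closedBall)

theorem eventually_circleFilter : ∀ᶠ z in circleFilter, ‖z‖ = 1 ∧ z ≠ 1 ∧ z ≠ -1 := by
  filter_upwards [circleFilter_le_edgeFilter eventually_edgeFilter,
    (self_mem_nhdsWithin : Metric.sphere (0 : ℂ) 1 \ {1} ∈ circleFilter)] with z h1 h2
  exact ⟨mem_sphere_zero_iff_norm.1 h2.1, h1.2.1, h1.2.2.1⟩

theorem tendsto_jostMinus_circle (hV : ∀ n, (V n).IsHermitian) (hmom : FiniteFirstMoment V)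
    (n : ℤ) : Tendsto (fun z => jostMinus V z n) circleFilter (𝓝 (jostMinus V 1 n)) := by
  refine (((tendsto_jostMinus_edge hV hmom n).comp tendsto_star_edgeFilter).mono_left
    circleFilter_le_edgeFilter).congr' ?_
  filter_upwards [eventually_circleFilter] with z hz
  rw [Function.comp_apply, star_eq_inv_of_norm_eq_one hz.1, inv_inv]

theorem tendsto_jostPlus_inv_circle (hV : ∀ n, (V n).IsHermitian) (hmom : FiniteFirstMoment V)
    (n : ℤ) : Tendsto (fun z => jostPlus V z⁻¹ n) circleFilter (𝓝 (jostPlus V 1 n)) := by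
  refine (((tendsto_jostPlus_edge hV hmom n).comp tendsto_star_edgeFilter).mono_left
    circleFilter_le_edgeFilter).congr' ?_
  filter_upwards [eventually_circleFilter] with z hz
  rw [Function.comp_apply, star_eq_inv_of_norm_eq_one hz.1]

/-- A solution of `b z * R z = a z - c z * T z` converges when `b` has an invertible limit. -/
theorem tendsto_reflection {l : Filter ℂ} {a b c R T : ℂ → Mat L} {a₀ c₀ T₀ g : Mat L}
    (ha : Tendsto a l (𝓝 a₀)) (hb : Tendsto b l (𝓝 a₀)) (hc : Tendsto c l (𝓝 c₀))
    (hT : Tendsto T l (𝓝 T₀)) (ha₀ : IsUnit a₀) (hg : c₀ * T₀ = a₀ * g)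
    (h : ∀ᶠ z in l, b z * R z = a z - c z * T z) : Tendsto R l (𝓝 (1 - g)) := by
  have h1 := (tendsto_nonsing_inv ha₀ hb).mul (ha.sub (hc.mul hT))
  have h2 := Matrix.nonsing_inv_mul _ ((Matrix.isUnit_iff_isUnit_det _).1 ha₀)
  rw [hg, mul_sub, ← mul_assoc, h2, one_mul] at h1
  refine h1.congr' ?_
  filter_upwards [h, hb.eventually (Units.isOpen.mem_nhds ha₀)] with z hz hu
  rw [← hz, ← mul_assoc, Matrix.nonsing_inv_mul _ ((Matrix.isUnit_iff_isUnit_det _).1 hu), one_mul]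

theorem tendsto_RPlus (hV : ∀ n, (V n).IsHermitian) (hmom : FiniteFirstMoment V)
    {G : spaceN V ≃ₗ[ℂ] spaceL V} (hG : ∀ (ξ : spaceN V) (n : ℤ),
      lin (jostPlus V 1 n) (ξ : Vec L) = lin (jostMinus V 1 n) (G ξ : Vec L)) {T : Mat L}
    (hM : ∀ᶠ z in edgeFilter, IsUnit (MPlus V z)) (hT : Tendsto (TPlus V) edgeFilter (𝓝 T))
    (hTr : LinearMap.range (lin T) = spaceN V) :
    Tendsto (RPlus V) circleFilter (𝓝 (1 - extendMat G.toLinearMap * T)) := by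
  obtain ⟨n, hn⟩ := (eventually_isUnit_of_tendsto_one (jostMinus_one_spec hV hmom).2).exists
  refine tendsto_reflection (tendsto_jostMinus_circle hV hmom n)
    ((tendsto_jostMinus_edge hV hmom n).mono_left circleFilter_le_edgeFilter)
    ((tendsto_jostPlus_edge hV hmom n).mono_left circleFilter_le_edgeFilter)
    (hT.mono_left circleFilter_le_edgeFilter) hn ?_ ?_
  · rw [← mul_assoc, ← jostPlus_mul_projMat hG, mul_assoc, projMat_mul_of_range_le hTr]
  · filter_upwards [eventually_circleFilter, circleFilter_le_edgeFilter hM] with z hz hMz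
    have h := (connection_coefficients hV hmom hz.1 hz.2.1 hz.2.2 (MPlus V z) (NPlus V z)).1.2
      ⟨rfl, rfl⟩ n
    have hM' := Matrix.mul_nonsing_inv _ ((Matrix.isUnit_iff_isUnit_det _).1 hMz)
    rw [h, RPlus, TPlus, add_mul, mul_assoc, hM', mul_one, neg_mul, mul_neg, mul_assoc]
    abel

theorem tendsto_RMinus (hV : ∀ n, (V n).IsHermitian) (hmom : FiniteFirstMoment V)
    {G : spaceN V ≃ₗ[ℂ] spaceL V} (hG : ∀ (ξ : spaceN V) (n : ℤ),
      lin (jostPlus V 1 n) (ξ : Vec L) = lin (jostMinus V 1 n) (G ξ : Vec L)) {T : Mat L}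
    (hM : ∀ᶠ z in edgeFilter, IsUnit (MMinus V z)) (hT : Tendsto (TMinus V) edgeFilter (𝓝 T))
    (hTr : LinearMap.range (lin T) = spaceL V) :
    Tendsto (RMinus V) circleFilter (𝓝 (1 - extendMat G.symm.toLinearMap * T)) := by
  obtain ⟨n, hn⟩ := (eventually_isUnit_of_tendsto_one (jostPlus_one_spec hV hmom).2).exists
  refine tendsto_reflection (tendsto_jostPlus_inv_circle hV hmom n)
    ((tendsto_jostPlus_edge hV hmom n).mono_left circleFilter_le_edgeFilter)
    ((tendsto_jostMinus_edge hV hmom n).mono_left circleFilter_le_edgeFilter)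
    (hT.mono_left circleFilter_le_edgeFilter) hn ?_ ?_
  · rw [← mul_assoc, ← jostMinus_mul_projMat hG, mul_assoc, projMat_mul_of_range_le hTr]
  · filter_upwards [eventually_circleFilter, circleFilter_le_edgeFilter hM] with z hz hMz
    have h := (connection_coefficients hV hmom hz.1 hz.2.1 hz.2.2 (MMinus V z) (NMinus V z)).2.2
      ⟨rfl, rfl⟩ n
    have hM' := Matrix.mul_nonsing_inv _ ((Matrix.isUnit_iff_isUnit_det _).1 hMz)
    rw [h, RMinus, TMinus, add_mul, mul_assoc _ (MMinus V z), hM', mul_one, neg_mul, mul_neg,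
      mul_assoc]
    abel

end Limits

end MatrixSchrodinger

open MatrixSchrodinger in
theorem theorem1p1 (L : ℕ) (V : ℤ → Mat L) (hV : ∀ n, (V n).IsHermitian)
    (hmom : FiniteFirstMoment V) :
    -- the Jost solutions exist and are unique
    (∀ z : ℂ, z ≠ 0 → ‖z‖ ≤ 1 →
      (∃! u, IsJostPlus V z u) ∧ (∃! u, IsJostMinus V z⁻¹ u)) ∧
    -- on the circle, `M_±` and `N_±` are the coefficients of the change of Jost basis
    (∀ z : ℂ, ‖z‖ = 1 → z ≠ 1 → z ≠ -1 → ∀ M N : Mat L,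
      ((∀ n, jostPlus V z n = jostMinus V z n * M + jostMinus V z⁻¹ n * N) ↔
        M = MPlus V z ∧ N = NPlus V z) ∧
      ((∀ n, jostMinus V z⁻¹ n = jostPlus V z n * N + jostPlus V z⁻¹ n * M) ↔
        M = MMinus V z ∧ N = NMinus V z)) ∧
    -- invertibility near `1` in the closed disk
    (∀ᶠ z in 𝓝[Metric.closedBall (0 : ℂ) 1 \ {1}] (1 : ℂ),
      IsUnit (MPlus V z) ∧ IsUnit (MMinus V z)) ∧
    -- `𝒩` and `ℒ` parametrize the half-bound states
    (∀ ξ : Vec L, ξ ∈ spaceN V ↔ ∃ C : ℝ, ∀ n, ‖lin (jostPlus V 1 n) ξ‖ ≤ C) ∧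
    (∀ χ : Vec L, χ ∈ spaceL V ↔ ∃ C : ℝ, ∀ n, ‖lin (jostMinus V 1 n) χ‖ ≤ C) ∧
    (∀ᶠ m : ℤ in atTop, IsUnit (jostPlus V 1 m)) ∧
    -- the bijection `Γ` and the limits at the band edge
    ∃ G : spaceN V ≃ₗ[ℂ] spaceL V, ∃ Tp Tm Rp Rm : Mat L,
      (∀ ξ : spaceN V,
        HasSum (fun j : ℤ => (j : ℂ) • lin (V j * jostPlus V 1 j) (ξ : Vec L))
          ((ξ : Vec L) - (G ξ : Vec L))) ∧
      Tendsto (TPlus V) (𝓝[Metric.closedBall (0 : ℂ) 1 \ {1}] (1 : ℂ)) (𝓝 Tp) ∧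
      Tendsto (TMinus V) (𝓝[Metric.closedBall (0 : ℂ) 1 \ {1}] (1 : ℂ)) (𝓝 Tm) ∧
      (∀ m : ℤ, IsUnit (jostPlus V 1 m) →
        ∀ (d d' : ℕ) (v e : OrthonormalBasis (Fin d ⊕ Fin d') ℂ (Vec L)),
          (∀ i, v (Sum.inl i) ∈ spaceN V) → (∀ i, v (Sum.inr i) ∈ (spaceN V)ᗮ) →
          (∀ i, e (Sum.inl i) ∈ spaceL V) → (∀ i, e (Sum.inr i) ∈ (spaceL V)ᗮ) →
          IsUnit (edgeMatrix V m G.toLinearMap v e) ∧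
          Tp = edgeTransmission V m G.toLinearMap v e) ∧
      Tm = Tpᴴ ∧
      LinearMap.range (lin Tp) = spaceN V ∧
      LinearMap.ker (lin Tp) = LinearMap.range (lin (wMinusPlus V)) ∧
      LinearMap.range (lin Tm) = spaceL V ∧
      LinearMap.ker (lin Tm) = LinearMap.range (lin (wPlusMinus V)) ∧
      Tendsto (RPlus V) (𝓝[Metric.sphere (0 : ℂ) 1 \ {1}] (1 : ℂ)) (𝓝 Rp) ∧
      Tendsto (RMinus V) (𝓝[Metric.sphere (0 : ℂ) 1 \ {1}] (1 : ℂ)) (𝓝 Rm) ∧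
      Rp = 1 - extendMat G.toLinearMap * Tp ∧
      Rm = 1 - extendMat G.symm.toLinearMap * Tm ∧
      LinearMap.range (lin (1 - Rp)) = spaceL V ∧
      LinearMap.ker (lin (1 - Rp)) = LinearMap.ker (lin Tp) ∧
      LinearMap.range (lin (1 - Rm)) = spaceN V ∧
      LinearMap.ker (lin (1 - Rm)) = LinearMap.ker (lin Tm) := by
  obtain ⟨G, hG⟩ := exists_gamma hV hmom
  have hunit := eventually_isUnit_of_tendsto_one (jostPlus_one_spec hV hmom).2
  obtain ⟨m₀, hm₀⟩ := hunit.exists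
  have hY := isUnit_limitMat hG hm₀
  obtain ⟨hMp, hTp⟩ := tendsto_TPlus hV hmom hG hm₀
  set Tp : Mat L := (2 : ℂ) • (projMat (spaceN V) * (limitMat V m₀ G.toLinearMap)⁻¹)
  have hrange : LinearMap.range (lin Tp) = spaceN V := range_transmission hY
  have hker : LinearMap.ker (lin Tp) = LinearMap.range (lin (wMinusPlus V)) := ker_transmission hY
  have hMm : ∀ᶠ z in edgeFilter, IsUnit (MMinus V z) := by
    filter_upwards [tendsto_star_edgeFilter.eventually hMp] with z hz
    rw [MMinus_eq]
    exact hz.star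
  have hTm : Tendsto (TMinus V) edgeFilter (𝓝 Tpᴴ) :=
    ((continuous_id.matrix_conjTranspose.tendsto Tp).comp
      (hTp.comp tendsto_star_edgeFilter)).congr fun z => (TMinus_eq z).symm
  have hrange' : LinearMap.range (lin Tpᴴ) = spaceL V := by
    rw [range_lin_conjTranspose, hker, ← ker_lin_conjTranspose, conjTranspose_wMinusPlus, spaceL]
  have hker' : LinearMap.ker (lin Tpᴴ) = LinearMap.range (lin (wPlusMinus V)) := by
    rw [ker_lin_conjTranspose, hrange, spaceN, ← range_lin_conjTranspose, conjTranspose_wMinusPlus]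
  refine ⟨fun z hz0 hz => ⟨existsUnique_isJostPlus hV hmom hz0 hz,
      existsUnique_isJostMinus hV hmom hz0 hz⟩,
    fun z hz h1 h2 M N => connection_coefficients hV hmom hz h1 h2 M N, hMp.and hMm,
    mem_spaceN_iff_bounded hV hmom, mem_spaceL_iff_bounded hV hmom, hunit, G, Tp, Tpᴴ,
    1 - extendMat G.toLinearMap * Tp, 1 - extendMat G.symm.toLinearMap * Tpᴴ,
    fun ξ => hasSum_gamma hV hmom (hG ξ), hTp, hTm, fun m hm d d' v e hv hv' he he' =>
      ⟨isUnit_edgeMatrix hG hm v e hv he he', ?_⟩, rfl, hrange, hker, hrange', hker',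
    tendsto_RPlus hV hmom hG hMp hTp hrange, tendsto_RMinus hV hmom hG hMm hTm hrange', rfl, rfl,
    ?_, ?_, ?_, ?_⟩
  -- Every site `m` with `u_+^1(m)` invertible may be used to compute the limit of `T_+`, so the
  -- formulas for different `m` agree by uniqueness of limits.
  · rw [← edgeTransmission_eq hG hm v e hv hv' he he']
    exact tendsto_nhds_unique hTp (tendsto_TPlus hV hmom hG hm).2
  · rw [sub_sub_cancel]
    exact range_extendMat_mul G hrange
  · rw [sub_sub_cancel]
    exact ker_extendMat_mul G hrange
  · rw [sub_sub_cancel]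
    exact range_extendMat_mul G.symm hrange'
  · rw [sub_sub_cancel]
    exact ker_extendMat_mul G.symm hrange'
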